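/- Let $R$ be a commutative ring and let $A$ be a commutative DG $R$-algebra: a homologically indexed $R$-complex with an associative, unital, graded-commutative product ($ab=(-1)^{|a||b|}ba$, and $a^2=0$ for $|a|$ odd) satisfying the Leibniz rule, with $A_i=0$ for $i<0$. Let $P$ and $Q$ be DG $A$-modules, where $Q$ is bounded below ($Q_n=0$ for $n\ll 0$) and graded-projective, i.e. $\operatorname{Hom}_A(Q,-)$ (the complex of $A$-linear homomorphisms of all degrees) preserves surjective morphisms of DG $A$-modules; for example, $Q$ may be any bounded below semi-free DG $A$-module. A semi-free resolution of $Q$ is a quasiisomorphism $F\to Q$ of DG $A$-modules such that $F$ is bounded below and its underlying graded module has a homogeneous basis over the underlying graded algebra of $A$; put $\operatorname{Ext}^i_A(Q,P):=\operatorname{H}_{-i}(\operatorname{Hom}_A(F,P))$. A categorically projective resolution of $Q$ is an exact sequence $\cdots\to L_1\to L_0\to Q\to 0$ of DG $A$-modules in which each $L_j$ is a projective object of the category of DG $A$-modules (with morphisms the degree-zero $A$-linear chain maps); $\operatorname{YExt}^i_A(Q,P)$ is the $i$-th cohomology group of the complex of groups of morphisms from $L_j$ to $P$, $j\ge 0$.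 Then $Q$ has a categorically projective resolution and a semi-free resolution, and for every choice of such resolutions there is an isomorphism of abelian groups $$\operatorname{YExt}^i_A(Q,P)\cong\operatorname{Ext}^i_A(Q,P)\qquad\text{for all } i\ge 1.$$ -/

import Mathlib

open CategoryTheory

universe u v

noncomputable section

/-- The degree-`n` homology `(G n ∩ ker D n) / D (n+1) (G (n+1))` of the (homologically indexed)
complex with terms `G n ⊆ V` and differentials `G n → G (n-1)` given by the restriction
of `D n : V → V`. -/
abbrev gradedCycles {R : Type u} [CommRing R] {V : Type v} [AddCommGroup V] [Module R V]
    (G : ℤ → Submodule R V) (D : ℤ → V →ₗ[R] V) (n : ℤ) : Submodule R V :=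
  G n ⊓ LinearMap.ker (D n)

/-- The degree-`n` boundaries, as a submodule of the cycles. -/
abbrev gradedBoundaries {R : Type u} [CommRing R] {V : Type v} [AddCommGroup V] [Module R V]
    (G : ℤ → Submodule R V) (D : ℤ → V →ₗ[R] V) (n : ℤ) :
    Submodule R (gradedCycles G D n) :=
  ((G (n + 1)).map (D (n + 1))).submoduleOf (gradedCycles G D n)

/-- The degree-`n` homology: cycles modulo boundaries. -/
abbrev gradedHomology {R : Type u} [CommRing R] {V : Type v} [AddCommGroup V] [Module R V]
    (G : ℤ → Submodule R V) (D : ℤ → V →ₗ[R] V) (n : ℤ) : Type v :=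
  gradedCycles G D n ⧸ gradedBoundaries G D n

/-- A commutative differential graded algebra over `R`, homologically and positively graded.
The carrier is the underlying algebra `⨁ i, A_i`, and `deg i` is the component `A_i`. -/
structure DGAlgebra (R : Type u) [CommRing R] where
  carrier : Type v
  [ring : Ring carrier]
  [algebra : Algebra R carrier]
  deg : ℤ → Submodule R carrier
  [graded : GradedAlgebra deg]
  /-- the differential, of degree `-1` -/
  d : carrier →ₗ[R] carrier
  d_mem : ∀ (n : ℤ) (a : carrier), a ∈ deg n → d a ∈ deg (n - 1)
  d_d : ∀ a : carrier, d (d a) = 0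
  leibniz : ∀ (i : ℤ) (a b : carrier), a ∈ deg i →
    d (a * b) = d a * b + i.negOnePow • (a * d b)
  graded_comm : ∀ (i j : ℤ) (a b : carrier), a ∈ deg i → b ∈ deg j →
    a * b = (i * j).negOnePow • (b * a)
  sq_zero : ∀ (i : ℤ) (a : carrier), Odd i → a ∈ deg i → a * a = 0
  nonneg : ∀ i : ℤ, i < 0 → deg i = ⊥

namespace DGAlgebra

instance (R : Type u) [CommRing R] : CoeSort (DGAlgebra.{u, v} R) (Type v) := ⟨carrier⟩

attribute [instance] DGAlgebra.ring DGAlgebra.algebra DGAlgebra.graded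

end DGAlgebra

/-- A DG module over the DG algebra `A`.  The carrier is the underlying module `⨁ i, M_i`
over the underlying algebra of `A`, and `deg i` is the component `M_i`. -/
structure DGModule {R : Type u} [CommRing R] (A : DGAlgebra.{u, v} R) where
  carrier : Type v
  [addCommGroup : AddCommGroup carrier]
  [moduleBase : Module R carrier]
  [module : Module A carrier]
  [tower : IsScalarTower R A carrier]
  deg : ℤ → Submodule R carrier
  [decomposition : DirectSum.Decomposition deg]
  smul_mem : ∀ (i j : ℤ) (a : A) (m : carrier), a ∈ A.deg i → m ∈ deg j →
    a • m ∈ deg (i + j)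
  /-- the differential, of degree `-1` -/
  d : carrier →ₗ[R] carrier
  d_mem : ∀ (n : ℤ) (m : carrier), m ∈ deg n → d m ∈ deg (n - 1)
  d_d : ∀ m : carrier, d (d m) = 0
  leibniz : ∀ (i : ℤ) (a : A) (m : carrier), a ∈ A.deg i →
    d (a • m) = A.d a • m + i.negOnePow • (a • d m)

namespace DGModule

variable {R : Type u} [CommRing R] {A : DGAlgebra.{u, v} R}

instance : CoeSort (DGModule A) (Type v) := ⟨carrier⟩

attribute [instance] DGModule.addCommGroup DGModule.moduleBase DGModule.module
  DGModule.tower DGModule.decomposition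

/-- The group of morphisms of DG `A`-modules: `A`-linear maps that preserve degrees and
commute with the differentials. -/
def morphisms (M N : DGModule A) : AddSubgroup (M →ₗ[A] N) where
  carrier := {f | (∀ (i : ℤ) (m : M), m ∈ M.deg i → f m ∈ N.deg i) ∧
    ∀ m : M, f (M.d m) = N.d (f m)}
  zero_mem' := ⟨fun i _ _ => (N.deg i).zero_mem, fun m => by simp⟩
  add_mem' := fun {f g} hf hg =>
    ⟨fun i m hm => (N.deg i).add_mem (hf.1 i m hm) (hg.1 i m hm), fun m => by
      simp [hf.2 m, hg.2 m]⟩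
  neg_mem' := fun {f} hf =>
    ⟨fun i m hm => (N.deg i).neg_mem (hf.1 i m hm), fun m => by simp [hf.2 m]⟩

/-- The category of DG `A`-modules. -/
instance : Category (DGModule A) where
  Hom M N := morphisms M N
  id M := ⟨LinearMap.id, fun _ _ hm => hm, fun _ => rfl⟩
  comp f g := ⟨g.1 ∘ₗ f.1, fun i m hm => g.2.1 i _ (f.2.1 i m hm), fun m => by
    simp [f.2.2 m, g.2.2 (f.1 m)]⟩

/-- The `A`-linear map on underlying modules of a morphism of DG modules. -/
def toLin {M N : DGModule A} (f : M ⟶ N) : M →ₗ[A] N := Subtype.val f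

instance : Preadditive (DGModule A) where
  homGroup M N := inferInstanceAs (AddCommGroup (morphisms M N))
  add_comp _ _ _ f f' g := Subtype.ext (LinearMap.comp_add f.1 f'.1 g.1)
  comp_add _ _ _ f g g' := Subtype.ext (LinearMap.add_comp f.1 g'.1 g.1)

/-- `M_n = 0` for all `n ≪ 0`. -/
def IsBoundedBelow (M : DGModule A) : Prop :=
  ∃ n₀ : ℤ, ∀ n : ℤ, n < n₀ → M.deg n = ⊥

/-- The homology module `H_n(M)`. -/
abbrev homology (M : DGModule A) (n : ℤ) : Type v :=
  gradedHomology M.deg (fun _ => M.d) n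

/-- The restriction of a morphism of DG modules to the cycles of degree `n`. -/
def cyclesMap {M N : DGModule A} (f : M ⟶ N) (n : ℤ) :
    gradedCycles M.deg (fun _ => M.d) n →ₗ[R] gradedCycles N.deg (fun _ => N.d) n :=
  ((toLin f).restrictScalars R).restrict fun m hm =>
    ⟨f.2.1 n m hm.1, by
      have h : N.d (toLin f m) = toLin f (M.d m) := (f.2.2 m).symm
      have h0 : M.d m = 0 := hm.2
      simp [h, h0]⟩

/-- The map `H_n(M) → H_n(N)` induced by a morphism of DG modules. -/
def homologyMap {M N : DGModule A} (f : M ⟶ N) (n : ℤ) : M.homology n →ₗ[R] N.homology n :=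
  Submodule.mapQ _ _ (cyclesMap f n) (by
    rintro ⟨m, hm⟩ ⟨x, hx, hxm⟩
    exact ⟨toLin f x, f.2.1 _ x hx, by
      have h : N.d (toLin f x) = toLin f (M.d x) := (f.2.2 x).symm
      have h' : M.d x = m := hxm
      change N.d (toLin f x) = toLin f m
      rw [h, h']⟩)

/-- Quasiisomorphisms of DG modules. -/
def IsQuasiIso {M N : DGModule A} (f : M ⟶ N) : Prop :=
  ∀ n : ℤ, Function.Bijective (homologyMap f n)

/-- `Hom_A(M, N)_n`: the homomorphisms `f` of degree `n`, which satisfy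
`f (a m) = (-1)^(n |a|) a f(m)`. -/
def homDeg (M N : DGModule A) (n : ℤ) : Submodule R (M →ₗ[R] N) where
  carrier := {f | (∀ (i : ℤ) (m : M), m ∈ M.deg i → f m ∈ N.deg (i + n)) ∧
    ∀ (i : ℤ) (a : A) (m : M), a ∈ A.deg i → f (a • m) = (n * i).negOnePow • (a • f m)}
  zero_mem' := ⟨fun i _ _ => (N.deg (i + n)).zero_mem, fun i a m _ => by simp⟩
  add_mem' := fun {f g} hf hg =>
    ⟨fun i m hm => (N.deg (i + n)).add_mem (hf.1 i m hm) (hg.1 i m hm), fun i a m ha => by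
      simp [hf.2 i a m ha, hg.2 i a m ha]⟩
  smul_mem' := fun r f hf =>
    ⟨fun i m hm => (N.deg (i + n)).smul_mem r (hf.1 i m hm), fun i a m ha => by
      simp only [LinearMap.smul_apply, hf.2 i a m ha]
      rw [smul_comm r, smul_comm r a]⟩

/-- The differential `f ↦ ∂ ∘ f - (-1)^n f ∘ ∂` on homomorphisms of degree `n`. -/
def homD (M N : DGModule A) (n : ℤ) : (M →ₗ[R] N) →ₗ[R] (M →ₗ[R] N) where
  toFun f := N.d ∘ₗ f - n.negOnePow • (f ∘ₗ M.d)
  map_add' f g := by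
    simp only [LinearMap.comp_add, LinearMap.add_comp, smul_add]
    abel
  map_smul' r f := by
    simp only [LinearMap.comp_smul, LinearMap.smul_comp, smul_sub, RingHom.id_apply]
    rw [smul_comm r]

/-- `H_n(Hom_A(M, N))`. -/
abbrev homHomology (M N : DGModule A) (n : ℤ) : Type v :=
  gradedHomology (homDeg M N) (homD M N) n

/-- `Q` is graded-projective if `Hom_A(Q, -)` preserves surjective morphisms. -/
def IsGradedProjective (Q : DGModule A) : Prop :=
  ∀ (M N : DGModule A) (f : M ⟶ N), Function.Surjective (toLin f) →
    ∀ (n : ℤ), ∀ g ∈ homDeg Q N n, ∃ h ∈ homDeg Q M n, ((toLin f).restrictScalars R) ∘ₗ h = g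

/-- `L` is semi-free if it is bounded below and has a semibasis, that is, the underlying
graded module has a basis (of homogeneous elements) over the underlying algebra of `A`. -/
def IsSemiFree (L : DGModule A) : Prop :=
  L.IsBoundedBelow ∧
    ∃ (ι : Type v) (e : Module.Basis ι A L), ∀ j : ι, ∃ n : ℤ, e j ∈ L.deg n

/-- A semi-free resolution `F → M`. -/
structure SemiFreeResolution (M : DGModule A) where
  F : DGModule A
  semiFree : F.IsSemiFree
  π : F ⟶ M
  quasiIso : IsQuasiIso π

/-- `Ext_A^i(M, N) = H_{-i}(Hom_A(F, N))`, for a semi-free resolution `F → M`. -/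
abbrev SemiFreeResolution.Ext {M : DGModule A} (F : SemiFreeResolution M) (N : DGModule A)
    (i : ℤ) : Type v :=
  homHomology F.F N (-i)

/-- A resolution `⋯ → L 1 → L 0 → M → 0` of `M` in the category of DG `A`-modules by
categorically projective DG modules, i.e. by projective objects of that category. -/
structure CatProjectiveResolution (M : DGModule A) where
  L : ℕ → DGModule A
  projective : ∀ j : ℕ, Projective (L j)
  diff : ∀ j : ℕ, L (j + 1) ⟶ L j
  π : L 0 ⟶ M
  surjective : Function.Surjective (toLin π)
  exact_zero : Function.Exact (toLin (diff 0)) (toLin π)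
  exact_succ : ∀ j : ℕ, Function.Exact (toLin (diff (j + 1))) (toLin (diff j))

namespace CatProjectiveResolution

variable {M : DGModule A} (L : CatProjectiveResolution M) (N : DGModule A)

/-- The cocycles of degree `i` in the complex `Hom(L 0, N) → Hom(L 1, N) → ⋯` of groups of
morphisms in the category of DG `A`-modules. -/
abbrev cocycles (i : ℕ) : AddSubgroup (L.L i ⟶ N) :=
  (Preadditive.leftComp N (L.diff i)).ker

/-- The coboundaries of degree `i` in the same complex. -/
def coboundaries : (i : ℕ) → AddSubgroup (L.L i ⟶ N)
  | 0 => ⊥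
  | j + 1 => (Preadditive.leftComp N (L.diff j)).range

/-- `YExt_A^i(M, N)`: the `i`-th cohomology of the complex of morphisms from a categorically
projective resolution of `M` to `N`. -/
abbrev YExt (i : ℕ) : Type v :=
  cocycles L N i ⧸ (coboundaries L N i).addSubgroupOf (cocycles L N i)

end CatProjectiveResolution

end DGModule

end

noncomputable section

/-! Both groups are the homology group `H_{-i}(Hom_A(Q, P))`.

For `YExt`: every DG module `M` is covered by a disk on a free module, which is contractible and has
a homogeneous basis. A projective object is a direct summand of its cover, hence contractible and
graded-projective. Let `K` be the kernel of `L 0 → Q`. As `Q` is graded-projective, `0 → K → L 0 → Q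
→ 0` has a graded splitting `s`. Since `L 0` is contractible, the differential of `s`, viewed as a
map `Q → K` of degree `-1`, is a homotopy equivalence; hence `H_n(Hom(Q, P))` is `H_{n+1}(Hom(K,
P))` (`homHomology_shift`). Moreover `K` is a graded retract of `L 0`, so the step can be repeated
along the resolution until only `YExt^1` is left. That group is `H_0(Hom(K, P))`, because a morphism
`K → P` extends to `L 0` exactly when it is null-homotopic (`yExt_one`).

For `Ext`: a semi-free resolution `F → Q` is a homotopy equivalence
(`homHomology_equiv_of_quasiIso`), provided that `Hom_A(F, -)` and `Hom_A(Q, -)` preserve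
acyclicity. For `F` a null-homotopy is built degree by degree on the basis
(`IsSemiFree.homAcyclic`). For `Q` an Eilenberg swindle shows that `Q` plus a disk on a free module
is semi-free (`exists_isSemiFree_prod`), and the property passes to the summand `Q`. The projection
from this sum to `Q` is also the required semi-free resolution. -/

lemma map_unit_zsmul {M N F : Type*} [AddCommGroup M] [AddCommGroup N] [FunLike F M N]
    [AddMonoidHomClass F M N] (f : F) (s : ℤˣ) (m : M) : f (s • m) = s • f m := by
  rw [Units.smul_def, Units.smul_def, map_zsmul]

/-! ### Graded modules: homogeneous projections and sign operators. -/

namespace Graded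

variable {R : Type u} [CommRing R] {V : Type v} [AddCommGroup V] [Module R V]
  {W : Type w} [AddCommGroup W] [Module R W]

section Decompose

variable (G : ℤ → Submodule R V) [DirectSum.Decomposition G]

/-- The projection onto the component of degree `n`. -/
def proj (n : ℤ) : V →ₗ[R] V :=
  (G n).subtype ∘ₗ DirectSum.component R ℤ (fun i => G i) n ∘ₗ
    (DirectSum.decomposeLinearEquiv G).toLinearMap

lemma proj_mem (n : ℤ) (x : V) : proj G n x ∈ G n :=
  Submodule.coe_mem _

variable {G}

lemma proj_same {n : ℤ} {x : V} (hx : x ∈ G n) : proj G n x = x :=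
  DirectSum.decompose_of_mem_same G hx

lemma proj_ne {n k : ℤ} {x : V} (hx : x ∈ G k) (h : k ≠ n) : proj G n x = 0 :=
  DirectSum.decompose_of_mem_ne G hx h

variable (G)

lemma hom_induction {p : V → Prop} (zero : p 0) (hom : ∀ i, ∀ x ∈ G i, p x)
    (add : ∀ x y, p x → p y → p (x + y)) (x : V) : p x :=
  DirectSum.Decomposition.inductionOn G zero (fun m => hom _ m.1 m.2) add x

lemma mem_iSup (x : V) : x ∈ ⨆ i, G i := by
  induction x using hom_induction G with
  | zero => exact zero_mem _
  | hom i x hx => exact Submodule.mem_iSup_of_mem i hx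
  | add x y hx hy => exact add_mem hx hy

variable {G}

lemma hom_ext {f g : V →ₗ[R] W} (h : ∀ i, ∀ x ∈ G i, f x = g x) : f = g :=
  LinearMap.ext fun x => by
    induction x using hom_induction G with
    | zero => simp
    | hom i x hx => exact h i x hx
    | add x y hx hy => simp [hx, hy]

variable (G) in
/-- The operator that multiplies elements of degree `i` with `(-1) ^ (k * i)`. -/
def sgn (k : ℤ) : V →ₗ[R] V :=
  DirectSum.toModule R ℤ V (fun i => (k * i).negOnePow • (G i).subtype) ∘ₗ
    (DirectSum.decomposeLinearEquiv G).toLinearMap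

lemma sgn_of_mem (k : ℤ) {i : ℤ} {x : V} (hx : x ∈ G i) :
    sgn G k x = (k * i).negOnePow • x := by
  have : DirectSum.decomposeLinearEquiv G x = DirectSum.lof R ℤ (fun i => G i) i ⟨x, hx⟩ :=
    DirectSum.decomposeLinearEquiv_apply_coe G i ⟨x, hx⟩
  simp [sgn, this, DirectSum.toModule_lof]

lemma sgn_mem (k : ℤ) {i : ℤ} {x : V} (hx : x ∈ G i) : sgn G k x ∈ G i := by
  rw [sgn_of_mem k hx, Units.smul_def]
  exact (G i).smul_of_tower_mem _ hx

lemma sgn_sgn (k : ℤ) (x : V) : sgn G k (sgn G k x) = x := by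
  have : sgn G k ∘ₗ sgn G k = LinearMap.id := hom_ext (G := G) fun i x hx => by
    rw [LinearMap.comp_apply, sgn_of_mem k hx, map_unit_zsmul, sgn_of_mem k hx, smul_smul]
    rcases Int.units_eq_one_or (k * i).negOnePow with h | h <;> simp [h]
  exact LinearMap.congr_fun this x

lemma proj_shift {H : ℤ → Submodule R W} [DirectSum.Decomposition H] {f : V →ₗ[R] W} {k : ℤ}
    (hf : ∀ i, ∀ x ∈ G i, f x ∈ H (i + k)) (n : ℤ) (x : V) :
    proj H (n + k) (f x) = f (proj G n x) := by
  induction x using hom_induction G with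
  | zero => simp
  | hom i x hx =>
    by_cases h : i = n
    · subst h
      rw [proj_same hx, proj_same (hf _ _ hx)]
    · rw [proj_ne hx h, proj_ne (hf _ _ hx) (by omega), map_zero]
  | add x y hx hy => simp only [map_add, hx, hy]

/-- Degreewise surjectivity of a surjective map of degree `k`. -/
lemma exists_preimage {H : ℤ → Submodule R W} [DirectSum.Decomposition H] {f : V →ₗ[R] W}
    {k : ℤ} (hf : ∀ i, ∀ x ∈ G i, f x ∈ H (i + k)) (hs : Function.Surjective f) {n m : ℤ} {y : W}
    (hy : y ∈ H m) (hm : m = n + k) : ∃ x ∈ G n, f x = y := by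
  subst hm
  obtain ⟨x, rfl⟩ := hs y
  exact ⟨proj G n x, proj_mem G n x, by rw [← proj_shift hf, proj_same hy]⟩

end Decompose

/-- A family of submodules with complete orthogonal projections is a decomposition. -/
@[reducible]
def decompositionOfProj (G : ℤ → Submodule R V) (π : ℤ → V →ₗ[R] V)
    (same : ∀ n, ∀ x ∈ G n, π n x = x) (ne : ∀ n k, ∀ x ∈ G k, k ≠ n → π n x = 0)
    (span : ∀ x, x ∈ ⨆ n, G n) : DirectSum.Decomposition G := by
  refine DirectSum.IsInternal.chooseDecomposition G
    (DirectSum.isInternal_submodule_of_iSupIndep_of_iSup_eq_top ?_ (eq_top_iff.2 fun x _ => span x))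
  intro n
  rw [Submodule.disjoint_def]
  intro x hx hx'
  rw [← same n x hx]
  have : (⨆ j, ⨆ (_ : j ≠ n), G j) ≤ LinearMap.ker (π n) :=
    iSup₂_le fun j hj y hy => ne n j y hy hj
  exact this hx'

end Graded

namespace DGModule

open Graded

variable {R : Type u} [CommRing R] {A : DGAlgebra.{u, v} R}

lemma toLin_mem {M N : DGModule A} (f : M ⟶ N) {i : ℤ} {x : M} (hx : x ∈ M.deg i) :
    toLin f x ∈ N.deg i :=
  f.2.1 i x hx

lemma toLin_d {M N : DGModule A} (f : M ⟶ N) (x : M) : toLin f (M.d x) = N.d (toLin f x) :=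
  f.2.2 x

lemma toLin_comp {M N K : DGModule A} (f : M ⟶ N) (g : N ⟶ K) (x : M) :
    toLin (f ≫ g) x = toLin g (toLin f x) :=
  rfl

lemma hom_ext {M N : DGModule A} {f g : M ⟶ N} (h : ∀ x, toLin f x = toLin g x) : f = g :=
  Subtype.ext (LinearMap.ext h)

lemma toLin_proj {M N : DGModule A} (f : M ⟶ N) (n : ℤ) (x : M) :
    proj N.deg n (toLin f x) = toLin f (proj M.deg n x) := by
  have := proj_shift (G := M.deg) (H := N.deg) (f := (toLin f).restrictScalars R) (k := 0)
    (fun i x hx => by simpa using toLin_mem f hx) n x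
  simpa using this

lemma d_mem' (M : DGModule A) {n k : ℤ} {x : M} (hx : x ∈ M.deg n) (h : k = n - 1) :
    M.d x ∈ M.deg k := by
  subst h; exact M.d_mem n x hx

/-! ### Submodules and quotients -/

/-- The DG submodule on a homogeneous submodule that is stable under the differential. -/
def sub (M : DGModule A) (S : Submodule A M) (hp : ∀ n, ∀ x ∈ S, proj M.deg n x ∈ S)
    (hd : ∀ x ∈ S, M.d x ∈ S) : DGModule A where
  carrier := S
  deg n := (M.deg n).comap (S.subtype.restrictScalars R)
  decomposition := by
    refine decompositionOfProj _
      (fun n => ⟨⟨fun x => ⟨proj M.deg n x, hp n x x.2⟩, fun x y => Subtype.ext (by simp)⟩,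
        fun r x => Subtype.ext (by simp)⟩)
      (fun n x hx => Subtype.ext (proj_same hx)) (fun n k x hx h => Subtype.ext (proj_ne hx h)) ?_
    classical
    intro x
    have : x = ∑ i ∈ (DirectSum.decompose M.deg (x : M)).support,
        (⟨proj M.deg i x, hp i x x.2⟩ : S) := by
      apply Subtype.ext
      rw [AddSubmonoidClass.coe_finsetSum]
      exact (DirectSum.sum_support_decompose M.deg (x : M)).symm
    rw [this]
    exact sum_mem fun i _ => Submodule.mem_iSup_of_mem i (proj_mem M.deg i x)
  smul_mem i j a m ha hm := M.smul_mem i j a m ha hm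
  d := ⟨⟨fun x => ⟨M.d x, hd x x.2⟩, fun x y => Subtype.ext (by simp)⟩,
    fun r x => Subtype.ext (by simp)⟩
  d_mem n m hm := M.d_mem n m hm
  d_d m := Subtype.ext (M.d_d m)
  leibniz i a m ha := Subtype.ext (by
    simpa [Units.smul_def] using M.leibniz i a m ha)

/-- The quotient of a DG module by a homogeneous submodule that is stable under the
differential. -/
def quot (M : DGModule A) (S : Submodule A M) (hp : ∀ n, ∀ x ∈ S, proj M.deg n x ∈ S)
    (hd : ∀ x ∈ S, M.d x ∈ S) : DGModule A where
  carrier := M ⧸ S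
  deg n := (M.deg n).map (S.mkQ.restrictScalars R)
  decomposition := by
    refine decompositionOfProj _
      (fun n => (S.restrictScalars R).mapQ (S.restrictScalars R) (proj M.deg n) (hp n)) ?_ ?_ ?_
    · rintro n _ ⟨x, hx, rfl⟩
      exact congrArg S.mkQ (proj_same hx)
    · rintro n k _ ⟨x, hx, rfl⟩ h
      exact (congrArg S.mkQ (proj_ne hx h)).trans (map_zero _)
    · intro x
      obtain ⟨x, rfl⟩ := S.mkQ_surjective x
      induction x using hom_induction M.deg with
      | zero => rw [map_zero]; exact zero_mem _
      | hom i x hx => exact Submodule.mem_iSup_of_mem i ⟨x, hx, rfl⟩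
      | add x y hx hy => rw [map_add]; exact add_mem hx hy
  smul_mem := by
    rintro i j a _ ha ⟨x, hx, rfl⟩
    exact ⟨a • x, M.smul_mem i j a x ha hx, rfl⟩
  d := (S.restrictScalars R).mapQ (S.restrictScalars R) M.d hd
  d_mem := by
    rintro n _ ⟨x, hx, rfl⟩
    exact ⟨M.d x, M.d_mem n x hx, rfl⟩
  d_d m := by
    obtain ⟨x, rfl⟩ := S.mkQ_surjective m
    exact (congrArg S.mkQ (M.d_d x)).trans (map_zero _)
  leibniz i a m ha := by
    obtain ⟨x, rfl⟩ := S.mkQ_surjective m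
    refine (congrArg S.mkQ (M.leibniz i a x ha)).trans ?_
    rw [map_add, map_unit_zsmul]
    rfl

/-- The quotient morphism. -/
def quotMk (M : DGModule A) (S : Submodule A M) (hp : ∀ n, ∀ x ∈ S, proj M.deg n x ∈ S)
    (hd : ∀ x ∈ S, M.d x ∈ S) : M ⟶ M.quot S hp hd :=
  ⟨S.mkQ, fun _ x hx => ⟨x, hx, rfl⟩, fun _ => rfl⟩

/-- Epimorphisms of DG modules are surjective. -/
lemma surjective_of_epi {M N : DGModule A} (f : M ⟶ N) [Epi f] :
    Function.Surjective (toLin f) := by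
  have hp : ∀ n, ∀ x ∈ LinearMap.range (toLin f), proj N.deg n x ∈ LinearMap.range (toLin f) := by
    rintro n _ ⟨x, rfl⟩
    exact ⟨_, (toLin_proj f n x).symm⟩
  have hd : ∀ x ∈ LinearMap.range (toLin f), N.d x ∈ LinearMap.range (toLin f) := by
    rintro _ ⟨x, rfl⟩
    exact ⟨_, toLin_d f x⟩
  -- The range is a DG submodule, so the quotient by it exists in the category; the quotient map
  -- vanishes after `f`, hence vanishes.
  have h : quotMk N _ hp hd = 0 := by
    rw [← cancel_epi f]
    exact hom_ext fun x => (Submodule.Quotient.mk_eq_zero _).2 ⟨x, rfl⟩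
  intro y
  have := congrArg (fun g => toLin g y) h
  exact (Submodule.Quotient.mk_eq_zero _).1 this

lemma epi_of_surjective {M N : DGModule A} (f : M ⟶ N) (hf : Function.Surjective (toLin f)) :
    Epi f :=
  ⟨fun g h e => hom_ext fun y => by
    obtain ⟨x, rfl⟩ := hf y
    rw [← toLin_comp, ← toLin_comp, e]⟩

/-- The kernel of a morphism of DG modules. -/
def ker {M N : DGModule A} (f : M ⟶ N) : DGModule A :=
  M.sub (LinearMap.ker (toLin f))
    (fun n x hx => by
      rw [LinearMap.mem_ker] at hx ⊢
      rw [← toLin_proj, hx, map_zero])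
    (fun x hx => by
      rw [LinearMap.mem_ker] at hx ⊢
      rw [toLin_d, hx, map_zero])

/-- The inclusion of the kernel. -/
def kerι {M N : DGModule A} (f : M ⟶ N) : ker f ⟶ M :=
  ⟨(LinearMap.ker (toLin f)).subtype, fun _ _ hx => hx, fun _ => rfl⟩

lemma kerι_injective {M N : DGModule A} (f : M ⟶ N) : Function.Injective (toLin (kerι f)) :=
  Subtype.val_injective

lemma exact_kerι {M N : DGModule A} (f : M ⟶ N) :
    Function.Exact (toLin (kerι f)) (toLin f) := fun y =>
  ⟨fun h => ⟨⟨y, h⟩, rfl⟩, by rintro ⟨x, rfl⟩; exact x.2⟩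

/-- The factorization of a morphism through the kernel. -/
def kerLift {M N K : DGModule A} (f : M ⟶ N) (g : K ⟶ M)
    (h : ∀ x, toLin f (toLin g x) = 0) : K ⟶ ker f :=
  ⟨(toLin g).codRestrict _ h, fun _ _ hx => toLin_mem g hx, fun x => Subtype.ext (toLin_d g x)⟩

/-! ### Products, shifts, disks and free modules -/

/-- The direct sum of two DG modules. -/
def prod (M N : DGModule A) : DGModule A where
  carrier := M × N
  deg n := (M.deg n).prod (N.deg n)
  decomposition := by
    refine decompositionOfProj _ (fun n => (proj M.deg n).prodMap (proj N.deg n))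
      (fun n x hx => Prod.ext (proj_same hx.1) (proj_same hx.2))
      (fun n k x hx h => Prod.ext (proj_ne hx.1 h) (proj_ne hx.2 h)) ?_
    rintro ⟨x, y⟩
    have h₁ : ∀ x : M, ((x, 0) : M × N) ∈ ⨆ n, (M.deg n).prod (N.deg n) := fun x => by
      induction x using hom_induction M.deg with
      | zero => exact zero_mem _
      | hom i x hx => exact Submodule.mem_iSup_of_mem i ⟨hx, zero_mem _⟩
      | add x y hx hy => simpa using add_mem hx hy
    have h₂ : ∀ y : N, ((0, y) : M × N) ∈ ⨆ n, (M.deg n).prod (N.deg n) := fun y => by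
      induction y using hom_induction N.deg with
      | zero => exact zero_mem _
      | hom i x hx => exact Submodule.mem_iSup_of_mem i ⟨zero_mem _, hx⟩
      | add x y hx hy => simpa using add_mem hx hy
    simpa using add_mem (h₁ x) (h₂ y)
  smul_mem i j a m ha hm := ⟨M.smul_mem i j a _ ha hm.1, N.smul_mem i j a _ ha hm.2⟩
  d := M.d.prodMap N.d
  d_mem n m hm := ⟨M.d_mem n _ hm.1, N.d_mem n _ hm.2⟩
  d_d m := Prod.ext (M.d_d _) (N.d_d _)
  leibniz i a m ha := Prod.ext (M.leibniz i a _ ha) (N.leibniz i a _ ha)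

/-- The shift of a DG module, with the same action and differential. -/
def shift (M : DGModule A) (k : ℤ) : DGModule A where
  carrier := M
  deg n := M.deg (n + k)
  decomposition := decompositionOfProj _ (fun n => proj M.deg (n + k))
    (fun n x hx => proj_same hx) (fun n l x hx h => proj_ne hx (by omega)) (fun x => by
      have : ⨆ n, M.deg n ≤ ⨆ n, M.deg (n + k) :=
        iSup_le fun i => le_iSup_of_le (i - k) (by rw [sub_add_cancel])
      exact this (mem_iSup M.deg x))
  smul_mem i j a m ha hm := by
    rw [add_assoc]; exact M.smul_mem i _ a m ha hm
  d := M.d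
  d_mem n m hm := by
    rw [sub_add_eq_add_sub]; exact M.d_mem _ m hm
  d_d := M.d_d
  leibniz := M.leibniz

/-- The differential lowers the degree by one, which flips the sign. This anticommutation makes the
differential of a disk square to zero. -/
lemma sgn_d (M : DGModule A) (x : M) : sgn M.deg 1 (M.d x) = - M.d (sgn M.deg 1 x) := by
  have : sgn M.deg 1 ∘ₗ M.d = -(M.d ∘ₗ sgn M.deg 1) := Graded.hom_ext (G := M.deg) fun i x hx => by
    simp only [LinearMap.comp_apply, LinearMap.neg_apply]
    rw [sgn_of_mem 1 hx, sgn_of_mem 1 (M.d_mem i x hx), map_unit_zsmul, one_mul, one_mul,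
      Int.negOnePow_sub]
    simp
  exact LinearMap.congr_fun this x

/-- The operator has degree `0` but obeys the sign rule of a homomorphism of degree `k`; composing
with it converts between the two conventions. -/
lemma sgn_smul (M : DGModule A) (k : ℤ) {i : ℤ} {a : A} (ha : a ∈ A.deg i) (x : M) :
    sgn M.deg k (a • x) = (k * i).negOnePow • (a • sgn M.deg k x) := by
  induction x using hom_induction M.deg with
  | zero => simp
  | hom j x hx =>
    rw [sgn_of_mem k hx, sgn_of_mem k (M.smul_mem i j a x ha hx), mul_add, Int.negOnePow_add,
      mul_smul, smul_comm a]
  | add x y hx hy => simp only [smul_add, map_add, hx, hy]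

/-- The contractible DG module with underlying graded module `X ⊕ X[1]`. -/
def disk (X : DGModule A) : DGModule A where
  carrier := X × X
  tower := Prod.isScalarTower
  deg := (X.prod (X.shift 1)).deg
  decomposition := (X.prod (X.shift 1)).decomposition
  smul_mem := (X.prod (X.shift 1)).smul_mem
  -- A cone of the identity. The shift carries no sign in its action or differential, so the
  -- identity is twisted by `sgn`, which supplies the signs for both `d_d` and the Leibniz rule.
  d := (X.d ∘ₗ LinearMap.fst R X X).prod
    (X.d ∘ₗ LinearMap.snd R X X + sgn X.deg 1 ∘ₗ LinearMap.fst R X X)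
  d_mem n m hm := ⟨X.d_mem n _ hm.1,
    add_mem ((X.shift 1).d_mem n _ hm.2) (by
      have := sgn_mem 1 hm.1
      change _ ∈ X.deg (n - 1 + 1)
      rwa [sub_add_cancel])⟩
  d_d m := Prod.ext (X.d_d _) (by
    change X.d (X.d m.2 + sgn X.deg 1 m.1) + sgn X.deg 1 (X.d m.1) = 0
    simp [X.d_d, sgn_d])
  leibniz i a m ha := Prod.ext (X.leibniz i a _ ha) (by
    change X.d (a • m.2) + sgn X.deg 1 (a • m.1) =
      A.d a • m.2 + i.negOnePow • (a • (X.d m.2 + sgn X.deg 1 m.1))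
    have h := sgn_smul X 1 ha m.1
    rw [one_mul] at h
    rw [h, X.leibniz i a _ ha, smul_add, smul_add, add_assoc])

/-- The free graded module on a set of homogeneous elements, with the differential that vanishes
on these. -/
def free (A : DGAlgebra.{u, v} R) {ι : Type v} (δ : ι → ℤ) : DGModule A where
  carrier := ι →₀ A
  deg n :=
    { carrier := {x | ∀ j, x j ∈ A.deg (n - δ j)}
      zero_mem' := fun _ => zero_mem _
      add_mem' := fun hx hy j => add_mem (hx j) (hy j)
      smul_mem' := fun r _ hx j => Submodule.smul_mem _ r (hx j) }
  decomposition := by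
    refine decompositionOfProj _ (fun n =>
      ⟨⟨fun x => Finsupp.onFinset x.support (fun j => proj A.deg (n - δ j) (x j))
        (fun j h => Finsupp.mem_support_iff.2 fun h' => h (by rw [h', map_zero])),
        fun x y => ?_⟩, fun r x => ?_⟩) ?_ ?_ ?_
    · ext j; simp
    · ext j; simp
    · intro n x hx
      ext j
      exact proj_same (hx j)
    · intro n k x hx h
      ext j
      exact proj_ne (hx j) (by omega)
    · intro x
      induction x using Finsupp.induction_linear with
      | zero => exact zero_mem _
      | add x y hx hy => exact add_mem hx hy
      | single j a =>
        induction a using hom_induction A.deg with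
        | zero => rw [Finsupp.single_zero]; exact zero_mem _
        | add x y hx hy => rw [Finsupp.single_add]; exact add_mem hx hy
        | hom i a ha =>
          refine Submodule.mem_iSup_of_mem (i + δ j) fun k => ?_
          by_cases h : j = k
          · subst h
            simpa using ha
          · rw [Finsupp.single_eq_of_ne' h]
            exact zero_mem _
  smul_mem i j a m ha hm k := by
    rw [add_sub_assoc]
    exact SetLike.mul_mem_graded ha (hm k)
  d := Finsupp.mapRange.linearMap A.d
  d_mem n m hm j := by
    rw [sub_right_comm]
    exact A.d_mem _ _ (hm j)
  d_d m := by ext; simp [A.d_d]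
  leibniz i a m ha := by
    ext j
    simp [A.leibniz i a _ ha, Units.smul_def]

/-! ### The calculus of homomorphisms of all degrees -/

section Calculus

variable {M N K : DGModule A}

/-- The underlying `R`-linear map of a morphism of DG modules. -/
abbrev lin (f : M ⟶ N) : M →ₗ[R] N := (toLin f).restrictScalars R

lemma comp_mem_homDeg {m n k : ℤ} {f : N →ₗ[R] K} {g : M →ₗ[R] N} (hf : f ∈ homDeg N K n)
    (hg : g ∈ homDeg M N m) (hk : k = m + n) : f ∘ₗ g ∈ homDeg M K k := by
  subst hk
  refine ⟨fun i x hx => ?_, fun i a x ha => ?_⟩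
  · rw [← add_assoc]
    exact hf.1 _ _ (hg.1 _ _ hx)
  · simp only [LinearMap.comp_apply]
    rw [hg.2 i a x ha, map_unit_zsmul, hf.2 i a _ ha, smul_smul, ← Int.negOnePow_add, add_mul]

lemma homD_apply (n : ℤ) (f : M →ₗ[R] N) (x : M) :
    homD M N n f x = N.d (f x) - n.negOnePow • f (M.d x) :=
  rfl

lemma homD_mem {n k : ℤ} {f : M →ₗ[R] N} (hf : f ∈ homDeg M N n) (hk : k = n - 1) :
    homD M N n f ∈ homDeg M N k := by
  subst hk
  refine ⟨fun i x hx => ?_, fun i a x ha => ?_⟩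
  · rw [homD_apply, Units.smul_def]
    refine sub_mem ?_ (Submodule.smul_of_tower_mem _ _ ?_)
    · exact N.d_mem' (hf.1 _ _ hx) (by ring)
    · have := hf.1 _ _ (M.d_mem i x hx)
      rwa [show i + (n - 1) = i - 1 + n by ring]
  · rw [homD_apply, homD_apply, M.leibniz i a x ha, map_add, map_unit_zsmul, hf.2 i a x ha,
      hf.2 i a _ ha, hf.2 (i - 1) _ _ (A.d_mem i a ha), map_unit_zsmul, N.leibniz i a _ ha,
      mul_sub n i, sub_mul n 1, Int.negOnePow_sub, Int.negOnePow_sub, mul_one, one_mul]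
    generalize (n * i).negOnePow = s
    generalize n.negOnePow = t
    generalize i.negOnePow = r
    rcases Int.units_eq_one_or s with rfl | rfl <;> rcases Int.units_eq_one_or t with rfl | rfl <;>
      rcases Int.units_eq_one_or r with rfl | rfl <;> simp [smul_sub, smul_add] <;> abel

/-- The Leibniz rule for composition. It is an identity of arbitrary `R`-linear maps, the degrees
entering only through signs, so no membership in `homDeg` is needed. -/
lemma homD_comp {m n k : ℤ} (f : N →ₗ[R] K) (g : M →ₗ[R] N) (hk : k = m + n) :
    homD M K k (f ∘ₗ g) =
      homD N K n f ∘ₗ g + n.negOnePow • (f ∘ₗ homD M N m g) := by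
  subst hk
  ext x
  simp only [homD_apply, LinearMap.add_apply, LinearMap.comp_apply, LinearMap.smul_apply, map_sub,
    map_unit_zsmul, Int.negOnePow_add, mul_smul, smul_sub]
  rw [smul_comm]
  abel

lemma homD_homD {n k : ℤ} (f : M →ₗ[R] N) (hk : k = n - 1) :
    homD M N k (homD M N n f) = 0 := by
  subst hk
  ext x
  simp only [homD_apply, map_sub, N.d_d, M.d_d, map_unit_zsmul, map_zero, Int.negOnePow_sub]
  simp

lemma id_mem_homDeg : (LinearMap.id : M →ₗ[R] M) ∈ homDeg M M 0 :=
  ⟨fun i x hx => by simpa using hx, fun i a x ha => by simp⟩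

lemma homD_id : homD M M 0 (LinearMap.id : M →ₗ[R] M) = 0 := by
  ext x; simp [homD_apply]

lemma lin_mem (f : M ⟶ N) : lin f ∈ homDeg M N 0 :=
  ⟨fun i x hx => by simpa using toLin_mem f hx, fun i a x ha => by simp⟩

lemma homD_lin (f : M ⟶ N) : homD M N 0 (lin f) = 0 := by
  ext x; simp [homD_apply, toLin_d]

/-- A homomorphism of degree `0` is linear. -/
lemma map_smul_of_mem_homDeg_zero {f : M →ₗ[R] N} (hf : f ∈ homDeg M N 0) (a : A) (x : M) :
    f (a • x) = a • f x := by
  induction a using hom_induction A.deg with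
  | zero => simp
  | hom i a ha => simpa using hf.2 i a x ha
  | add a b ha hb => simp only [add_smul, map_add, ha, hb]

/-- The morphism of DG modules given by a cycle of degree `0`. -/
def ofCycle (f : M →ₗ[R] N) (hf : f ∈ homDeg M N 0) (hd : homD M N 0 f = 0) : M ⟶ N :=
  ⟨⟨f.toAddHom, map_smul_of_mem_homDeg_zero hf⟩, fun i x hx => by simpa using hf.1 i x hx,
    fun x => by
      have := LinearMap.congr_fun hd x
      rw [homD_apply] at this
      exact (by simpa [sub_eq_zero] using this : N.d (f x) = f (M.d x)).symm⟩

lemma unit_smul_mem_homDeg {n : ℤ} {f : M →ₗ[R] N} (hf : f ∈ homDeg M N n) (s : ℤˣ) :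
    s • f ∈ homDeg M N n := by
  rw [Units.smul_def]
  exact Submodule.smul_of_tower_mem _ _ hf

/-- Factoring homomorphisms through a kernel. -/
lemma exists_lift_kernel {X Y Z : DGModule A} {j : X ⟶ Y} {p : Y ⟶ Z}
    (hj : Function.Injective (toLin j)) (hex : Function.Exact (toLin j) (toLin p)) {n : ℤ}
    {f : M →ₗ[R] Y} (hf : f ∈ homDeg M Y n) (hpf : ∀ x, toLin p (f x) = 0) :
    ∃ g ∈ homDeg M X n, lin j ∘ₗ g = f := by
  have H : ∀ x, ∃ y, lin j y = f x := fun x => (hex (f x)).1 (hpf x)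
  choose g hg using H
  have hj' : Function.Injective (lin j) := hj
  let g' : M →ₗ[R] X := ⟨⟨g, fun x y => hj' (by simp only [hg, map_add])⟩,
    fun r x => hj' (by simp only [hg, map_smul, RingHom.id_apply])⟩
  have hg' : ∀ x, lin j (g' x) = f x := hg
  have hdeg : ∀ i, ∀ x : X, lin j x ∈ Y.deg i → x ∈ X.deg i := fun i x hx => by
    have : proj X.deg i x = x := hj (by rw [← toLin_proj]; exact proj_same hx)
    rw [← this]
    exact proj_mem _ _ _
  refine ⟨g', ⟨fun i x hx => hdeg _ _ ?_, fun i a x ha => hj' ?_⟩, LinearMap.ext hg⟩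
  · rw [hg']; exact hf.1 i x hx
  · rw [hg', hf.2 i a x ha, map_unit_zsmul, ← hg']
    simp

lemma homD_lin_comp {n : ℤ} (j : N ⟶ K) (g : M →ₗ[R] N) :
    homD M K n (lin j ∘ₗ g) = lin j ∘ₗ homD M N n g := by
  rw [homD_comp (m := n) (n := 0) _ _ (by simp), homD_lin]
  simp

lemma homD_comp_lin {n : ℤ} (f : N →ₗ[R] K) (g : M ⟶ N) :
    homD M K n (f ∘ₗ lin g) = homD N K n f ∘ₗ lin g := by
  rw [homD_comp (m := 0) (n := n) _ _ (by simp), homD_lin]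
  simp

lemma lin_comp_mem {n : ℤ} (j : N ⟶ K) {g : M →ₗ[R] N} (hg : g ∈ homDeg M N n) :
    lin j ∘ₗ g ∈ homDeg M K n :=
  comp_mem_homDeg (lin_mem j) hg (by simp)

lemma comp_lin_mem {n : ℤ} {f : N →ₗ[R] K} (hf : f ∈ homDeg N K n) (g : M ⟶ N) :
    f ∘ₗ lin g ∈ homDeg M K n :=
  comp_mem_homDeg hf (lin_mem g) (by simp)

/-- Precomposition with a homotopy equivalence of degree `m` is bijective on homology. -/
theorem homHomology_equiv {K Q : DGModule A} {m : ℤ} {θ : K →ₗ[R] Q} {δ : Q →ₗ[R] K}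
    {h : Q →ₗ[R] Q} {h' : K →ₗ[R] K} (hθ : θ ∈ homDeg K Q m) (dθ : homD K Q m θ = 0)
    (hδ : δ ∈ homDeg Q K (-m)) (dδ : homD Q K (-m) δ = 0)
    (hh : h ∈ homDeg Q Q 1) (dh : θ ∘ₗ δ = LinearMap.id + homD Q Q 1 h)
    (hh' : h' ∈ homDeg K K 1) (dh' : δ ∘ₗ θ = LinearMap.id + homD K K 1 h')
    (P : DGModule A) {n n' : ℤ} (hn : n' = n + m) :
    Nonempty (homHomology Q P n ≃+ homHomology K P n') := by
  have hc : ∀ f ∈ gradedCycles (homDeg Q P) (homD Q P) n,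
      LinearMap.lcomp R P.carrier θ f ∈ gradedCycles (homDeg K P) (homD K P) n' := by
    rintro f ⟨hf, df⟩
    refine ⟨comp_mem_homDeg hf hθ (by omega), ?_⟩
    change homD K P n' (f ∘ₗ θ) = 0
    replace df : homD Q P n f = 0 := df
    rw [homD_comp (m := m) (n := n) _ _ (by omega), df, dθ]
    simp
  let c := (LinearMap.lcomp R P.carrier θ).restrict hc
  have hb : gradedBoundaries (homDeg Q P) (homD Q P) n ≤
      (gradedBoundaries (homDeg K P) (homD K P) n').comap c := by
    rintro ⟨f, hf⟩ ⟨g, hg, dg⟩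
    refine ⟨g ∘ₗ θ, comp_mem_homDeg hg hθ (by omega), ?_⟩
    change homD K P (n' + 1) (g ∘ₗ θ) = f ∘ₗ θ
    rw [homD_comp (m := m) (n := n + 1) _ _ (by omega), dg, dθ]
    simp
  let Φ := Submodule.mapQ _ _ c hb
  have inj : Function.Injective Φ := by
    rw [injective_iff_map_eq_zero]
    intro x hx
    obtain ⟨⟨f, hf, df⟩, rfl⟩ := Submodule.mkQ_surjective _ x
    obtain ⟨g, hg, dg⟩ := (Submodule.Quotient.mk_eq_zero _).1 hx
    replace dg : homD K P (n' + 1) g = f ∘ₗ θ := dg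
    replace df : homD Q P n f = 0 := df
    -- If `f ∘ θ` bounds `g`, then `g ∘ δ` has differential `f ∘ θ ∘ δ`, which is `f` plus `f`
    -- composed with the differential of `h`; the second term of the witness removes the excess.
    refine (Submodule.Quotient.mk_eq_zero _).2
      ⟨g ∘ₗ δ - n.negOnePow • (f ∘ₗ h),
        sub_mem (comp_mem_homDeg hg hδ (by omega))
          (unit_smul_mem_homDeg (comp_mem_homDeg hf hh (by omega)) _), ?_⟩
    change homD Q P (n + 1) _ = f
    rw [map_sub, map_unit_zsmul, homD_comp (m := -m) (n := n' + 1) _ _ (by omega),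
      homD_comp (m := 1) (n := n) _ _ (by omega), dg, df, dδ, LinearMap.comp_assoc, dh,
      LinearMap.comp_add]
    rcases Int.units_eq_one_or n.negOnePow with e | e <;> simp [e]
  have surj : Function.Surjective Φ := by
    intro x
    obtain ⟨⟨g, hg, dg⟩, rfl⟩ := Submodule.mkQ_surjective _ x
    replace dg : homD K P n' g = 0 := dg
    -- The class of `g ∘ δ` maps to that of `g ∘ δ ∘ θ`, which differs from `g` by the boundary of
    -- `± g ∘ h'`.
    refine ⟨Submodule.Quotient.mk ⟨g ∘ₗ δ, comp_mem_homDeg hg hδ (by omega), ?_⟩, ?_⟩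
    · change homD Q P n (g ∘ₗ δ) = 0
      rw [homD_comp (m := -m) (n := n') _ _ (by omega), dg, dδ]
      simp
    · refine (Submodule.Quotient.eq _).2 ⟨n'.negOnePow • (g ∘ₗ h'),
        unit_smul_mem_homDeg (comp_mem_homDeg hg hh' (by omega)) _, ?_⟩
      change homD K P (n' + 1) _ = (g ∘ₗ δ) ∘ₗ θ - g
      rw [map_unit_zsmul, homD_comp (m := 1) (n := n') _ _ (by omega), dg, LinearMap.comp_assoc,
        dh', LinearMap.comp_add]
      rcases Int.units_eq_one_or n'.negOnePow with e | e <;> simp [e]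
  exact ⟨(LinearEquiv.ofBijective Φ ⟨inj, surj⟩).toAddEquiv⟩

end Calculus

/-! ### Modules with a homogeneous basis -/

section Basis

variable {M : DGModule A} {ι : Type w} (e : Module.Basis ι A M) {δ : ι → ℤ}
  (he : ∀ j, e j ∈ M.deg (δ j)) {N : DGModule A}

lemma proj_smul (a : A) {x : M} {k : ℤ} (hx : x ∈ M.deg k) (i : ℤ) :
    proj M.deg i (a • x) = proj A.deg (i - k) a • x := by
  have := proj_shift (G := A.deg) (H := M.deg) (k := k)
    (f := (LinearMap.toSpanSingleton A M x).restrictScalars R)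
    (fun i b hb => M.smul_mem i k b x hb hx) (i - k) a
  rw [sub_add_cancel] at this
  exact this

include he in
lemma repr_proj (i : ℤ) (x : M) (j : ι) :
    e.repr (proj M.deg i x) j = proj A.deg (i - δ j) (e.repr x j) := by
  obtain ⟨x, rfl⟩ := e.repr.symm.surjective x
  induction x using Finsupp.induction_linear with
  | zero => simp
  | add x y hx hy => simp only [map_add, Finsupp.add_apply, hx, hy]
  | single k a =>
    rw [Module.Basis.repr_symm_single, proj_smul a (he k)]
    by_cases h : k = j
    · subst h; simp
    · simp [h]

include he in
lemma repr_mem {i : ℤ} {x : M} (hx : x ∈ M.deg i) (j : ι) : e.repr x j ∈ A.deg (i - δ j) := by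
  rw [← proj_same hx, repr_proj e he]
  exact proj_mem _ _ _

/-- Homomorphisms of degree `n` that agree on the basis elements of degree at most `i` agree on
elements of degree `i`. -/
lemma eq_of_eq_on_basis {n : ℤ} {f g : M →ₗ[R] N} (hf : f ∈ homDeg M N n) (hg : g ∈ homDeg M N n)
    {i : ℤ} (h : ∀ j, δ j ≤ i → f (e j) = g (e j)) {x : M} (hx : x ∈ M.deg i)
    (he : ∀ j, e j ∈ M.deg (δ j)) : f x = g x := by
  rw [← e.linearCombination_repr x, Finsupp.linearCombination_apply, Finsupp.sum, map_sum, map_sum]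
  refine Finset.sum_congr rfl fun j _ => ?_
  have hr := repr_mem e he hx j
  by_cases hj : δ j ≤ i
  · rw [hf.2 _ _ _ hr, hg.2 _ _ _ hr, h j hj]
  -- The coefficient of a basis element of degree above `i` has negative degree in `A`, so it is
  -- zero.
  · rw [A.nonneg _ (by omega), Submodule.mem_bot] at hr
    rw [hr]
    simp

/-- The homomorphism of degree `n` with given values on a homogeneous basis. -/
def homOfBasis (N : DGModule A) (n : ℤ) (y : ι → N) : M →ₗ[R] N :=
  -- Moving a coefficient past a map of degree `n` costs the sign that `sgn A.deg n` inserts.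
  Finsupp.lsum R (fun j =>
    (LinearMap.toSpanSingleton A N (y j)).restrictScalars R ∘ₗ sgn A.deg n) ∘ₗ
      (e.repr.toLinearMap.restrictScalars R)

lemma homOfBasis_apply (n : ℤ) (y : ι → N) (x : M) :
    homOfBasis e N n y x = (e.repr x).sum fun j a => sgn A.deg n a • y j :=
  rfl

lemma one_mem_deg_zero : (1 : A) ∈ A.deg 0 := SetLike.GradedOne.one_mem

lemma homOfBasis_basis (n : ℤ) (y : ι → N) (j : ι) : homOfBasis e N n y (e j) = y j := by
  rw [homOfBasis_apply, Module.Basis.repr_self, Finsupp.sum_single_index (by simp),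
    sgn_of_mem n one_mem_deg_zero]
  simp

lemma sgn_mul (n : ℤ) {i : ℤ} {a : A} (ha : a ∈ A.deg i) (b : A) :
    sgn A.deg n (a * b) = (n * i).negOnePow • (a * sgn A.deg n b) := by
  induction b using hom_induction A.deg with
  | zero => simp
  | hom j x hx =>
    rw [sgn_of_mem n hx, sgn_of_mem n (SetLike.mul_mem_graded ha hx), mul_add, Int.negOnePow_add,
      mul_smul, mul_smul_comm]
  | add x y hx hy => simp only [mul_add, smul_add, map_add, hx, hy]

include he in
lemma homOfBasis_mem {n : ℤ} {y : ι → N} (hy : ∀ j, y j ∈ N.deg (δ j + n)) :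
    homOfBasis e N n y ∈ homDeg M N n := by
  refine ⟨fun i x hx => ?_, fun i a x ha => ?_⟩
  · rw [homOfBasis_apply]
    refine sum_mem fun j _ => ?_
    have := N.smul_mem _ _ _ _ (sgn_mem n (repr_mem e he hx j)) (hy j)
    rwa [show i - δ j + (δ j + n) = i + n by ring] at this
  · rw [homOfBasis_apply, homOfBasis_apply, map_smul, Finsupp.sum_smul_index (by simp),
      Finsupp.smul_sum, Finsupp.smul_sum]
    refine Finsupp.sum_congr fun j _ => ?_
    rw [sgn_mul n ha, smul_assoc, mul_smul]

include he in
/-- A DG module with a homogeneous basis is graded-projective. -/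
lemma isGradedProjective_of_basis : M.IsGradedProjective := by
  intro X Y f hf n g hg
  have H : ∀ j, ∃ x ∈ X.deg (δ j + n), lin f x = g (e j) := fun j =>
    exists_preimage (k := 0) (fun i x hx => by simpa using toLin_mem f hx) hf
      (hg.1 _ _ (he j)) (by simp)
  choose y hy hfy using H
  have hm := homOfBasis_mem e he hy
  refine ⟨_, hm, Graded.hom_ext (G := M.deg) fun i x hx => ?_⟩
  refine eq_of_eq_on_basis e (lin_comp_mem f hm) hg (fun j _ => ?_) hx he
  rw [LinearMap.comp_apply, homOfBasis_basis, hfy]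

end Basis

/-! ### Disks are contractible -/

section Disk

variable (X : DGModule A) {N : DGModule A}

/-- The contraction of a disk. -/
def diskContraction : disk X →ₗ[R] disk X :=
  (LinearMap.inl R X X) ∘ₗ sgn X.deg 1 ∘ₗ LinearMap.snd R X X

lemma diskContraction_mem : diskContraction X ∈ homDeg (disk X) (disk X) 1 := by
  refine ⟨fun i x hx => ⟨sgn_mem 1 hx.2, zero_mem _⟩, fun i a x ha => Prod.ext ?_ ?_⟩
  · exact sgn_smul X 1 ha x.2
  · change (0 : X) = (1 * i).negOnePow • (a • (0 : X))
    simp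

lemma homD_diskContraction : homD (disk X) (disk X) 1 (diskContraction X) = LinearMap.id := by
  ext x
  rw [homD_apply, Int.negOnePow_one, Units.smul_def, Units.val_neg, Units.val_one, neg_one_smul,
    sub_neg_eq_add]
  refine Prod.ext ?_ ?_
  · change X.d (sgn X.deg 1 x.2) + sgn X.deg 1 (X.d x.2 + sgn X.deg 1 x.1) = x.1
    rw [map_add, sgn_d, sgn_sgn]
    abel
  · change X.d 0 + sgn X.deg 1 (sgn X.deg 1 x.2) + 0 = x.2
    rw [sgn_sgn]
    simp

variable {X}

/-- The morphism from the disk that extends a homomorphism of degree `0`. -/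
def diskLift (g : X →ₗ[R] N) (hg : g ∈ homDeg X N 0) : disk X ⟶ N :=
  -- The second summand is forced: `(0, y)` is the differential of `(sgn y, 0)` minus `(d (sgn y),
  -- 0)`.
  ofCycle (M := disk X) (g ∘ₗ LinearMap.fst R X X +
      homD X N 0 g ∘ₗ sgn X.deg 1 ∘ₗ LinearMap.snd R X X)
    (by
      have hd := homD_mem hg (k := -1) (by norm_num)
      refine ⟨fun i x hx => add_mem (hg.1 _ _ hx.1) ?_, fun i a x ha => ?_⟩
      · have := hd.1 _ _ (sgn_mem 1 hx.2)
        rwa [show i + 1 + -1 = i + 0 by ring] at this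
      · change g (a • x.1) + homD X N 0 g (sgn X.deg 1 (a • x.2)) =
          _ • (a • (g x.1 + homD X N 0 g (sgn X.deg 1 x.2)))
        rw [hg.2 i a _ ha, sgn_smul X 1 ha, map_unit_zsmul, hd.2 i a _ ha, smul_smul, neg_mul,
          Int.negOnePow_neg, ← Int.negOnePow_add, Int.negOnePow_even _ (Even.add_self _)]
        simp)
    (by
      ext x
      change N.d (g x.1 + homD X N 0 g (sgn X.deg 1 x.2)) - (0 : ℤ).negOnePow •
        (g (X.d x.1) + homD X N 0 g (sgn X.deg 1 (X.d x.2 + sgn X.deg 1 x.1))) = 0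
      simp only [homD_apply, map_add, map_sub, sgn_d, sgn_sgn, Int.negOnePow_zero, one_smul,
        map_neg, N.d_d, X.d_d]
      abel_nf
      simp)

/-- The inclusion of the underlying graded module of `X` into the disk. -/
def diskInl (X : DGModule A) : X →ₗ[R] disk X := LinearMap.inl R X X

lemma diskInl_mem : diskInl X ∈ homDeg X (disk X) 0 := by
  refine ⟨fun i x hx => ⟨?_, zero_mem _⟩, fun i a x ha => Prod.ext ?_ ?_⟩
  · change x ∈ X.deg (i + 0)
    rwa [add_zero]
  · change a • x = (0 * i).negOnePow • (a • x)
    simp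
  · change (0 : X) = (0 * i).negOnePow • (a • (0 : X))
    simp

lemma diskLift_diskInl (g : X →ₗ[R] N) (hg : g ∈ homDeg X N 0) (x : X) :
    toLin (diskLift g hg) (diskInl X x) = g x := by
  change g x + homD X N 0 g (sgn X.deg 1 0) = g x
  simp

/-- The image of `diskInl` together with its differentials spans the disk. With `diskLift`,
morphisms out of the disk thus correspond to homomorphisms of degree `0` out of `X`, with no
condition on differentials. -/
lemma disk_hom_ext {f g : disk X ⟶ N}
    (h : ∀ x, toLin f (diskInl X x) = toLin g (diskInl X x)) : f = g := by
  refine hom_ext fun x => ?_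
  have hx : x = diskInl X x.1 +
      ((disk X).d (diskInl X (sgn X.deg 1 x.2)) - diskInl X (X.d (sgn X.deg 1 x.2))) := by
    refine Prod.ext ?_ ?_
    · change x.1 = x.1 + (X.d (sgn X.deg 1 x.2) - X.d (sgn X.deg 1 x.2))
      simp
    · change x.2 = 0 + (X.d 0 + sgn X.deg 1 (sgn X.deg 1 x.2) - 0)
      rw [sgn_sgn]
      simp
  rw [hx]
  simp only [map_add, map_sub, h, toLin_d]

/-- The disk on a graded-projective DG module is categorically projective. -/
lemma projective_disk (hX : X.IsGradedProjective) : Projective (disk X) where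
  factors {Y Z} f p _ := by
    -- A lifting problem for the disk is a lifting problem for degree `0` homomorphisms from `X`.
    obtain ⟨g, hg, hpg⟩ := hX Y Z p (surjective_of_epi p) 0 (lin f ∘ₗ diskInl X)
      (lin_comp_mem f diskInl_mem)
    refine ⟨diskLift g hg, disk_hom_ext fun x => ?_⟩
    rw [toLin_comp, diskLift_diskInl]
    exact LinearMap.congr_fun hpg x

end Disk

/-! ### Enough projectives -/

section Free

/-- The standard basis of a free DG module. -/
def freeBasis (A : DGAlgebra.{u, v} R) {ι : Type v} (δ : ι → ℤ) :
    Module.Basis ι A (free A δ) :=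
  Module.Basis.ofRepr (LinearEquiv.refl A (ι →₀ A))

lemma freeBasis_mem {ι : Type v} (δ : ι → ℤ) (j : ι) :
    freeBasis A δ j ∈ (free A δ).deg (δ j) := fun k => by
  change Finsupp.single j (1 : A) k ∈ _
  by_cases h : j = k
  · subst h
    simpa using one_mem_deg_zero
  · rw [Finsupp.single_eq_of_ne' h]
    exact zero_mem _

/-- A homogeneous basis of the disk on a free module. -/
def diskFreeBasis (A : DGAlgebra.{u, v} R) {ι : Type v} (δ : ι → ℤ) :
    Module.Basis (ι ⊕ ι) A (disk (free A δ)) :=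
  (freeBasis A δ).prod (freeBasis A δ)

lemma diskFreeBasis_mem {ι : Type v} (δ : ι → ℤ) (j : ι ⊕ ι) :
    diskFreeBasis A δ j ∈
      (disk (free A δ)).deg (Sum.elim δ (fun j => δ j - 1) j) := by
  rcases j with j | j
  · exact ⟨Set.mem_of_eq_of_mem (Module.Basis.prod_apply_inl_fst (freeBasis A δ) (freeBasis A δ) j)
      (freeBasis_mem δ j), Set.mem_of_eq_of_mem (Module.Basis.prod_apply_inl_snd (freeBasis A δ) (freeBasis A δ) j) (zero_mem _)⟩
  · refine ⟨Set.mem_of_eq_of_mem (Module.Basis.prod_apply_inr_fst (freeBasis A δ) (freeBasis A δ) j) (zero_mem _),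
      Set.mem_of_eq_of_mem (Module.Basis.prod_apply_inr_snd (freeBasis A δ) (freeBasis A δ) j) ?_⟩
    change _ ∈ (free A δ).deg (δ j - 1 + 1)
    rw [sub_add_cancel]
    exact freeBasis_mem δ j

lemma isGradedProjective_free {ι : Type v} (δ : ι → ℤ) : (free A δ).IsGradedProjective :=
  isGradedProjective_of_basis (freeBasis A δ) (freeBasis_mem δ)

variable (M : DGModule A)

/-- The nonzero homogeneous elements of a DG module. -/
abbrev Gen : Type v := {x : Σ n, M.deg n // x.2 ≠ 0}

/-- The degree of a nonzero homogeneous element. -/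
abbrev genDeg (x : M.Gen) : ℤ := x.1.1

/-- A categorically projective and contractible DG module that covers `M`. -/
abbrev cover : DGModule A := disk (free A M.genDeg)

lemma projective_cover : Projective M.cover := projective_disk (isGradedProjective_free _)

lemma isGradedProjective_cover : M.cover.IsGradedProjective :=
  isGradedProjective_of_basis (diskFreeBasis A _) (diskFreeBasis_mem _)

/-- The covering morphism. -/
def coverMap : M.cover ⟶ M :=
  diskLift (homOfBasis (freeBasis A M.genDeg) M 0 fun x => (x.1.2 : M))
    (homOfBasis_mem _ (freeBasis_mem _) fun x => by simp)

lemma coverMap_surjective : Function.Surjective (toLin M.coverMap) := by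
  rw [← LinearMap.range_eq_top, eq_top_iff]
  intro x _
  induction x using hom_induction M.deg with
  | zero => exact zero_mem _
  | add x y hx hy => exact add_mem (hx trivial) (hy trivial)
  | hom i x hx =>
    by_cases h : x = 0
    · rw [h]; exact zero_mem _
    · let j : M.Gen := ⟨⟨i, x, hx⟩, fun h' => h (congrArg Subtype.val h')⟩
      refine ⟨diskInl _ (freeBasis A M.genDeg j), ?_⟩
      rw [coverMap, diskLift_diskInl, homOfBasis_basis]

/-- The iterated syzygies of a DG module with respect to the covers. -/
def syz : ℕ → DGModule A
  | 0 => M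
  | n + 1 => ker (syz n).coverMap

lemma exact_comp_kerι {M N K : DGModule A} {f : M ⟶ N} (g : K ⟶ ker f)
    (hg : Function.Surjective (toLin g)) :
    Function.Exact (toLin (g ≫ kerι f)) (toLin f) := by
  intro y
  rw [exact_kerι f y]
  constructor
  · rintro ⟨x, rfl⟩
    obtain ⟨z, rfl⟩ := hg x
    exact ⟨z, rfl⟩
  · rintro ⟨z, rfl⟩
    exact ⟨_, rfl⟩

lemma exact_comp_right {M N K L : DGModule A} {f : M ⟶ N} {g : N ⟶ K} {j : K ⟶ L}
    (h : Function.Exact (toLin f) (toLin g)) (hj : Function.Injective (toLin j)) :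
    Function.Exact (toLin f) (toLin (g ≫ j)) := fun y => by
  rw [← h y, toLin_comp, map_eq_zero_iff _ hj]

/-- Every DG module has a categorically projective resolution. -/
def catProjectiveResolution : CatProjectiveResolution M where
  L n := (M.syz n).cover
  projective _ := projective_cover _
  diff n := coverMap (ker (M.syz n).coverMap) ≫ kerι (M.syz n).coverMap
  π := M.coverMap
  surjective := M.coverMap_surjective
  exact_zero := exact_comp_kerι (f := M.coverMap) _ (coverMap_surjective _)
  exact_succ _ := exact_comp_right (exact_comp_kerι (f := coverMap (ker (M.syz _).coverMap)) _
    (coverMap_surjective _)) (kerι_injective _)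

end Free

/-! ### Yoneda Ext groups -/

section Retract

variable {K L : DGModule A}

/-- Graded retracts of graded-projective DG modules are graded-projective. -/
lemma IsGradedProjective.of_retract (hL : L.IsGradedProjective) {i : K →ₗ[R] L} {r : L →ₗ[R] K}
    (hi : i ∈ homDeg K L 0) (hr : r ∈ homDeg L K 0) (hri : r ∘ₗ i = LinearMap.id) :
    K.IsGradedProjective := by
  intro M N f hf n g hg
  obtain ⟨h, hh, e⟩ := hL M N f hf n (g ∘ₗ r) (comp_mem_homDeg hg hr (by omega))
  refine ⟨h ∘ₗ i, comp_mem_homDeg hh hi (by omega), ?_⟩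
  rw [← LinearMap.comp_assoc, e, LinearMap.comp_assoc, hri, LinearMap.comp_id]

/-- A contraction of a DG module. -/
def IsContraction (L : DGModule A) (c : L →ₗ[R] L) : Prop :=
  c ∈ homDeg L L 1 ∧ homD L L 1 c = LinearMap.id

lemma exists_retract_cover (L : DGModule A) [Projective L] :
    ∃ i : L ⟶ L.cover, i ≫ L.coverMap = 𝟙 L :=
  have := epi_of_surjective _ L.coverMap_surjective
  ⟨Projective.factorThru (𝟙 L) L.coverMap, Projective.factorThru_comp _ _⟩

lemma lin_comp_lin_eq_id {i : K ⟶ L} {p : L ⟶ K} (h : i ≫ p = 𝟙 K) :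
    lin p ∘ₗ lin i = LinearMap.id :=
  LinearMap.ext fun x => congrArg (fun f => toLin f x) h

/-- A projective object is a direct summand of its cover, which has a homogeneous basis. -/
lemma isGradedProjective_of_projective (L : DGModule A) [Projective L] :
    L.IsGradedProjective := by
  obtain ⟨i, hi⟩ := L.exists_retract_cover
  exact (isGradedProjective_cover L).of_retract (lin_mem i) (lin_mem _) (lin_comp_lin_eq_id hi)

/-- Categorically projective DG modules are contractible. -/
lemma exists_contraction_of_projective (L : DGModule A) [Projective L] :
    ∃ c, L.IsContraction c := by
  obtain ⟨i, hi⟩ := L.exists_retract_cover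
  -- The contraction of the cover is compressed to the summand; `homD` commutes with composition by
  -- morphisms.
  refine ⟨lin L.coverMap ∘ₗ diskContraction _ ∘ₗ lin i,
    lin_comp_mem _ (comp_lin_mem (diskContraction_mem _) _), ?_⟩
  rw [homD_lin_comp, homD_comp_lin, homD_diskContraction]
  exact lin_comp_lin_eq_id hi

end Retract

/-! ### Graded splittings and dimension shifting. -/

section ShortExact

variable {K L Q : DGModule A} {j : K ⟶ L} {p : L ⟶ Q}

lemma lin_comp_cancel {M : DGModule A} (hj : Function.Injective (toLin j))
    {f g : M →ₗ[R] K} (h : lin j ∘ₗ f = lin j ∘ₗ g) : f = g :=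
  LinearMap.ext fun x => hj (LinearMap.congr_fun h x)

/-- Graded splittings of a short exact sequence that ends with a graded-projective module. -/
lemma exists_splitting (hj : Function.Injective (toLin j)) (hjp : Function.Exact (toLin j) (toLin p))
    (hp : Function.Surjective (toLin p)) (hQ : Q.IsGradedProjective) :
    ∃ s ∈ homDeg Q L 0, ∃ r ∈ homDeg L K 0, lin p ∘ₗ s = LinearMap.id ∧
      r ∘ₗ lin j = LinearMap.id ∧ lin j ∘ₗ r = LinearMap.id - s ∘ₗ lin p := by
  obtain ⟨s, hs, hps⟩ := hQ L Q p hp 0 LinearMap.id id_mem_homDeg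
  have hps' : ∀ x, toLin p (s x) = x := LinearMap.congr_fun hps
  obtain ⟨r, hr, hjr⟩ := exists_lift_kernel hj hjp
    (f := LinearMap.id - s ∘ₗ lin p) (sub_mem id_mem_homDeg (comp_lin_mem hs p))
    (fun x => by
      change toLin p (x - s (toLin p x)) = 0
      rw [map_sub, hps', sub_self])
  refine ⟨s, hs, r, hr, hps, lin_comp_cancel hj ?_, hjr⟩
  rw [← LinearMap.comp_assoc, hjr]
  ext x
  have : toLin p (toLin j x) = 0 := hjp.apply_apply_eq_zero x
  simp [this]

/-- Dimension shifting along a short exact sequence with contractible middle term. -/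
theorem homHomology_shift (hj : Function.Injective (toLin j))
    (hjp : Function.Exact (toLin j) (toLin p)) (hp : Function.Surjective (toLin p))
    (hQ : Q.IsGradedProjective) {c : L →ₗ[R] L} (hc : L.IsContraction c) (P : DGModule A)
    {n n' : ℤ} (hn : n' = n + 1) :
    Nonempty (homHomology Q P n ≃+ homHomology K P n') := by
  obtain ⟨s, hs, r, hr, hps, hrj, hjr⟩ := exists_splitting hj hjp hp hQ
  obtain ⟨hc, dc⟩ := hc
  -- The splitting `s` need not commute with differentials. Its differential is killed by `p`, so it
  -- factors through `K` as the connecting map `δ` of degree `-1`.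
  have hσ := homD_mem hs (k := -1) (by norm_num)
  have hpσ : lin p ∘ₗ homD Q L 0 s = 0 := by
    rw [← homD_lin_comp, hps, homD_id]
  obtain ⟨δ, hδ, hjδ⟩ := exists_lift_kernel hj hjp hσ (LinearMap.congr_fun hpσ)
  have dδ : homD Q K (-1) δ = 0 := lin_comp_cancel hj (by
    rw [← homD_lin_comp, hjδ, homD_homD _ (by norm_num), LinearMap.comp_zero])
  have dr : homD L K 0 r = -(δ ∘ₗ lin p) := lin_comp_cancel hj (by
    rw [← homD_lin_comp, hjr, map_sub, homD_id, homD_comp_lin, LinearMap.comp_neg,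
      ← LinearMap.comp_assoc, hjδ, zero_sub])
  -- The homotopy inverse of `δ` is `p ∘ c ∘ j`, a cycle because its differential is `p ∘ j = 0`.
  -- The homotopies are found by differentiating `p ∘ c ∘ s` and `r ∘ c ∘ j`.
  refine homHomology_equiv (θ := lin p ∘ₗ c ∘ₗ lin j) (δ := δ) (h := -(lin p ∘ₗ c ∘ₗ s))
    (h' := -(r ∘ₗ c ∘ₗ lin j)) (lin_comp_mem p (comp_lin_mem hc j)) ?_ hδ dδ
    (neg_mem (lin_comp_mem p (comp_mem_homDeg hc hs (by norm_num)))) ?_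
    (neg_mem (comp_mem_homDeg hr (comp_lin_mem hc j) (by norm_num))) ?_ P hn
  · rw [homD_lin_comp, homD_comp_lin, dc, LinearMap.id_comp]
    exact LinearMap.ext fun x => hjp.apply_apply_eq_zero x
  · rw [LinearMap.comp_assoc, LinearMap.comp_assoc, hjδ, map_neg, homD_lin_comp,
      homD_comp (m := 0) (n := 1) _ _ (by norm_num), dc]
    simp [LinearMap.comp_add, hps]
  · rw [map_neg, homD_comp (m := 1) (n := 0) _ _ (by norm_num), homD_comp_lin, dc, dr]
    simp [hrj, LinearMap.comp_assoc]

end ShortExact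

/-- Factoring a morphism through a surjective one. -/
lemma exists_desc {M N P : DGModule A} {q : M ⟶ N} (hq : Function.Surjective (toLin q))
    (f : M ⟶ P) (h : ∀ x, toLin q x = 0 → toLin f x = 0) : ∃ g : N ⟶ P, q ≫ g = f := by
  have hf : ∀ x y, toLin q x = toLin q y → toLin f x = toLin f y := fun x y e => by
    rw [← sub_eq_zero, ← map_sub]
    exact h _ (by rw [map_sub, e, sub_self])
  let s := Function.surjInv hq
  have hs : ∀ y, toLin q (s y) = y := Function.surjInv_eq hq
  have hg : ∀ x, toLin f (s (toLin q x)) = toLin f x := fun x => hf _ _ (hs _)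
  refine ⟨⟨⟨⟨fun y => toLin f (s y), fun y z => ?_⟩, fun a y => ?_⟩, fun i y hy => ?_, fun y => ?_⟩,
    hom_ext hg⟩
  · rw [← map_add]
    exact hf _ _ (by simp only [map_add, hs])
  · rw [RingHom.id_apply, ← map_smul]
    exact hf _ _ (by simp only [map_smul, hs])
  · obtain ⟨x, hx, rfl⟩ := exists_preimage (f := lin q) (k := 0)
      (fun i x hx => by simpa using toLin_mem q hx) hq (n := i) hy (by simp)
    change toLin f (s (toLin q x)) ∈ _
    rw [hg]
    exact toLin_mem f hx
  · change toLin f (s (N.d y)) = P.d (toLin f (s y))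
    rw [← toLin_d]
    exact hf _ _ (by rw [toLin_d, hs, hs])

lemma nonempty_addEquiv_of_ker_eq {G X Y : Type*} [AddCommGroup G] [AddCommGroup X]
    [AddCommGroup Y] (f : G →+ X) (g : G →+ Y) (hf : Function.Surjective f)
    (hg : Function.Surjective g) (h : ∀ x, f x = 0 ↔ g x = 0) : Nonempty (X ≃+ Y) :=
  ⟨(QuotientAddGroup.quotientKerEquivOfSurjective f hf).symm.trans
    ((QuotientAddGroup.quotientAddEquivOfEq (AddSubgroup.ext h)).trans
      (QuotientAddGroup.quotientKerEquivOfSurjective g hg))⟩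

/-! ### Yoneda Ext by induction along syzygies. -/

namespace CatProjectiveResolution

variable {Q : DGModule A} (L : CatProjectiveResolution Q)

/-- The morphism from the first term of a resolution to the first syzygy. -/
def toSyzygy : L.L 1 ⟶ ker L.π :=
  kerLift L.π (L.diff 0) L.exact_zero.apply_apply_eq_zero

lemma kerι_toSyzygy (x : L.L 1) : toLin (kerι L.π) (toLin L.toSyzygy x) = toLin (L.diff 0) x :=
  rfl

lemma toSyzygy_surjective : Function.Surjective (toLin L.toSyzygy) := by
  rintro ⟨y, hy⟩
  obtain ⟨x, rfl⟩ := (L.exact_zero y).1 hy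
  exact ⟨x, rfl⟩

lemma toSyzygy_eq_zero_iff (x : L.L 1) : toLin L.toSyzygy x = 0 ↔ toLin (L.diff 0) x = 0 := by
  rw [← kerι_toSyzygy, map_eq_zero_iff _ (kerι_injective _)]

/-- The resolution of the first syzygy obtained by truncation. -/
def tail : CatProjectiveResolution (ker L.π) where
  L j := L.L (j + 1)
  projective j := L.projective (j + 1)
  diff j := L.diff (j + 1)
  π := L.toSyzygy
  surjective := L.toSyzygy_surjective
  exact_zero x := (L.toSyzygy_eq_zero_iff x).trans (L.exact_succ 0 x)
  exact_succ j := L.exact_succ (j + 1)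

/-- The first Yoneda Ext group is the group of homotopy classes of morphisms from the syzygy. -/
theorem yExt_one (hQ : Q.IsGradedProjective) (P : DGModule A) :
    Nonempty (homHomology (ker L.π) P 0 ≃+ L.YExt P 1) := by
  have := L.projective 0
  obtain ⟨c, hc, dc⟩ := exists_contraction_of_projective (L.L 0)
  obtain ⟨s, hs, r, hr, hps, hrj, hjr⟩ := exists_splitting (kerι_injective L.π)
    (exact_kerι L.π) L.surjective hQ
  -- As `L 2 → L 1 → K → 0` is exact, cocycles on `L 1` are exactly the morphisms out of the syzygy
  -- `K`.
  let Φ : gradedCycles (homDeg (ker L.π) P) (homD (ker L.π) P) 0 →+ L.cocycles P 1 :=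
    { toFun := fun φ => ⟨L.toSyzygy ≫ ofCycle φ.1 φ.2.1 φ.2.2, hom_ext fun x => by
        change φ.1 (toLin L.toSyzygy (toLin (L.diff 1) x)) = 0
        rw [(L.toSyzygy_eq_zero_iff _).2 ((L.exact_succ 0).apply_apply_eq_zero x), map_zero]⟩
      map_zero' := rfl
      map_add' := fun _ _ => rfl }
  have hΦ : ∀ φ x, toLin (Φ φ).1 x = φ.1 (toLin L.toSyzygy x) := fun _ _ => rfl
  have hs : Function.Surjective Φ := by
    rintro ⟨f, hf⟩
    have hf' : ∀ x, toLin f (toLin (L.diff 1) x) = 0 := fun x =>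
      congrArg (fun g => toLin g x) (AddMonoidHom.mem_ker.1 hf)
    obtain ⟨g, hg⟩ := exists_desc L.toSyzygy_surjective f (fun x hx => by
      obtain ⟨y, rfl⟩ := (L.exact_succ 0 x).1 ((L.toSyzygy_eq_zero_iff x).1 hx)
      exact hf' y)
    exact ⟨⟨lin g, lin_mem g, homD_lin g⟩, Subtype.ext (hom_ext fun x =>
      congrArg (fun g => toLin g x) hg)⟩
  refine nonempty_addEquiv_of_ker_eq (Submodule.mkQ _).toAddMonoidHom
    ((QuotientAddGroup.mk' _).comp Φ) (Submodule.mkQ_surjective _)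
    ((QuotientAddGroup.mk'_surjective _).comp hs) ?_
  rintro φ
  refine (Submodule.Quotient.mk_eq_zero _).trans (Iff.trans ?_ (QuotientAddGroup.eq_zero_iff _).symm)
  constructor
  · rintro ⟨h, hh, dh⟩
    have hhr := comp_mem_homDeg (k := 1) hh hr (by norm_num)
    -- If `φ` is the differential of `h`, the differential of `h ∘ r` is a morphism on `L 0`; it
    -- extends `φ` because `r` is a retraction onto `K`.
    refine ⟨ofCycle (homD _ P 1 (h ∘ₗ r)) (homD_mem hhr (by norm_num))
      (homD_homD _ (by norm_num)), hom_ext fun x => ?_⟩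
    change homD _ P 1 (h ∘ₗ r) (lin (kerι L.π) (toLin L.toSyzygy x)) = φ.1 (toLin L.toSyzygy x)
    rw [← LinearMap.comp_apply, ← homD_comp_lin, LinearMap.comp_assoc, hrj, LinearMap.comp_id]
    exact LinearMap.congr_fun dh _
  · rintro ⟨g, hg⟩
    have hg' : ∀ x, φ.1 (toLin L.toSyzygy x) = toLin g (toLin (L.diff 0) x) := fun x =>
      (congrArg (fun g => toLin g x) hg).symm
    -- Conversely, an extension `g` of `φ` to `L 0` is contracted by `c`, and the restriction to `K`
    -- is a null-homotopy of `φ`.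
    refine ⟨lin g ∘ₗ c ∘ₗ lin (kerι L.π), lin_comp_mem g (comp_lin_mem hc _), ?_⟩
    change homD _ P 1 _ = φ.1
    rw [homD_lin_comp, homD_comp_lin, dc]
    ext y
    obtain ⟨x, rfl⟩ := L.toSyzygy_surjective y
    rw [hg']
    rfl

/-- Yoneda Ext groups of a graded-projective DG module are the homology groups of the complex of
homomorphisms. -/
theorem yExt_equiv (P : DGModule A) (i : ℕ) : ∀ {Q : DGModule A} (L : CatProjectiveResolution Q),
    Q.IsGradedProjective →
      Nonempty (homHomology Q P (-((i + 1 : ℕ) : ℤ)) ≃+ L.YExt P (i + 1)) := by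
  induction i with
  | zero =>
    intro Q L hQ
    have := L.projective 0
    obtain ⟨c, hc⟩ := exists_contraction_of_projective (L.L 0)
    obtain ⟨e₁⟩ := homHomology_shift (kerι_injective L.π) (exact_kerι L.π) L.surjective hQ hc P
      (n := -((0 + 1 : ℕ) : ℤ)) (n' := 0) (by norm_num)
    obtain ⟨e₂⟩ := L.yExt_one hQ P
    exact ⟨e₁.trans e₂⟩
  | succ i ih =>
    intro Q L hQ
    have := L.projective 0
    obtain ⟨c, hc⟩ := exists_contraction_of_projective (L.L 0)
    obtain ⟨s, hs, r, hr, hps, hrj, hjr⟩ := exists_splitting (kerι_injective L.π)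
      (exact_kerι L.π) L.surjective hQ
    obtain ⟨e₁⟩ := homHomology_shift (kerι_injective L.π) (exact_kerι L.π) L.surjective hQ hc P
      (n := -((i + 1 + 1 : ℕ) : ℤ)) (n' := -((i + 1 : ℕ) : ℤ)) (by push_cast; ring)
    -- The syzygy is a graded retract of `L 0`, hence again graded-projective, and the truncated
    -- resolution resolves it.
    obtain ⟨e₂⟩ := ih L.tail ((isGradedProjective_of_projective (L.L 0)).of_retract
      (lin_mem _) hr hrj)
    exact ⟨e₁.trans e₂⟩

end CatProjectiveResolution

end DGModule

/-! ### The Eilenberg swindle -/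

section Swindle

variable {A : Type*} [Ring A] {G Q : Type*} [AddCommGroup G] [Module A G] [AddCommGroup Q]
  [Module A Q] (p : G →ₗ[A] Q) (s : Q →ₗ[A] G)

/-- The inverse of the swindle isomorphism. -/
def swindleInv : (ℕ →₀ G) →ₗ[A] Q × (ℕ →₀ G) :=
  (p ∘ₗ Finsupp.lapply 0).prod (LinearMap.id - Finsupp.mapRange.linearMap (s ∘ₗ p) +
    Finsupp.lcomapDomain Nat.succ Nat.succ_injective ∘ₗ Finsupp.mapRange.linearMap (s ∘ₗ p))

/-- The swindle homomorphism. -/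
def swindleHom : Q × (ℕ →₀ G) →ₗ[A] (ℕ →₀ G) :=
  -- When `p ∘ s` is the identity, `s ∘ p` is an idempotent splitting each slot into a copy of `Q`
  -- and a complement. Complements stay in place, each copy of `Q` moves up one slot, and the extra
  -- `Q` fills slot `0`.
  LinearMap.coprod (Finsupp.lsingle 0 ∘ₗ s) (LinearMap.id - Finsupp.mapRange.linearMap (s ∘ₗ p) +
    Finsupp.lmapDomain G A Nat.succ ∘ₗ Finsupp.mapRange.linearMap (s ∘ₗ p))

lemma swindleHom_zero (x : Q × (ℕ →₀ G)) :
    swindleHom p s x 0 = s x.1 + (x.2 0 - s (p (x.2 0))) := by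
  simp [swindleHom, Finsupp.mapDomain_of_notMem_range]

lemma swindleHom_succ (x : Q × (ℕ →₀ G)) (n : ℕ) :
    swindleHom p s x (n + 1) = s (p (x.2 n)) + (x.2 (n + 1) - s (p (x.2 (n + 1)))) := by
  have := Finsupp.mapDomain_apply Nat.succ_injective (Finsupp.mapRange (s ∘ₗ p) (map_zero _) x.2) n
  simp at this
  simp [swindleHom, this, add_comm]

lemma swindleInv_fst (x : ℕ →₀ G) : (swindleInv p s x).1 = p (x 0) := rfl

lemma swindleInv_snd (x : ℕ →₀ G) (n : ℕ) :
    (swindleInv p s x).2 n = x n - s (p (x n)) + s (p (x (n + 1))) := by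
  simp [swindleInv, Finsupp.lcomapDomain]

/-- If `Q` is a retract of `G`, then `Q ⊕ G^(ℕ)` is isomorphic to `G^(ℕ)`. -/
def swindle (h : ∀ x, p (s x) = x) : (Q × (ℕ →₀ G)) ≃ₗ[A] (ℕ →₀ G) :=
  LinearEquiv.ofLinearMap (swindleHom p s) (swindleInv p s)
    (by
      refine LinearMap.ext fun x => Finsupp.ext fun n => ?_
      cases n <;> simp [swindleHom_zero, swindleHom_succ, swindleInv_fst, swindleInv_snd, h])
    (by
      refine LinearMap.ext fun x => Prod.ext ?_ (Finsupp.ext fun n => ?_)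
      · simp [swindleHom_zero, swindleInv_fst, h]
      · cases n <;> simp [swindleHom_zero, swindleHom_succ, swindleInv_snd, h])

end Swindle

/-! ### Stabilizing graded-projective modules to semi-free ones. -/

namespace DGModule

open Graded

variable {R : Type u} [CommRing R] {A : DGAlgebra.{u, v} R}

lemma isBoundedBelow_free {ι : Type v} {δ : ι → ℤ} {n₀ : ℤ} (h : ∀ j, n₀ ≤ δ j) {n : ℤ}
    (hn : n < n₀) : (free A δ).deg n = ⊥ := by
  rw [eq_bot_iff]
  intro x hx
  refine (Submodule.mem_bot R).2 (Finsupp.ext fun j => ?_)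
  have h₁ := hx j
  have h₂ := h j
  rw [A.nonneg _ (by omega)] at h₁
  exact h₁

/-- A bounded below graded-projective DG module becomes semi-free after adding a suitable
contractible free summand. -/
theorem exists_isSemiFree_prod (Q : DGModule A) (hQ : Q.IsGradedProjective)
    (hb : Q.IsBoundedBelow) :
    ∃ (κ : Type v) (δ : κ → ℤ), (Q.prod (disk (free A δ))).IsSemiFree := by
  -- Only a graded section is available, which suffices because a semibasis ignores the
  -- differential.
  obtain ⟨s, hs, hps⟩ := hQ Q.cover Q Q.coverMap Q.coverMap_surjective 0 LinearMap.id id_mem_homDeg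
  obtain ⟨n₀, hn₀⟩ := hb
  let δ₀ : Q.Gen ⊕ Q.Gen → ℤ := Sum.elim Q.genDeg (fun j => Q.genDeg j - 1)
  let b := diskFreeBasis A Q.genDeg
  have hbδ : ∀ j, b j ∈ Q.cover.deg (δ₀ j) := diskFreeBasis_mem _
  -- Here it matters that zero is excluded from `Gen`: otherwise generators would occur in every
  -- degree.
  have hgen : ∀ j, n₀ ≤ Q.genDeg j := fun j => by
    by_contra h
    have := (hn₀ _ (not_le.1 h)).le j.1.2.2
    exact j.2 (Subtype.ext this)
  have hδ₀ : ∀ j, n₀ - 1 ≤ δ₀ j := by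
    rintro (j | j)
    · have := hgen j
      change n₀ - 1 ≤ Q.genDeg j
      omega
    · have := hgen j
      change n₀ - 1 ≤ Q.genDeg j - 1
      omega
  let sA : Q →ₗ[A] Q.cover := ⟨s.toAddHom, map_smul_of_mem_homDeg_zero hs⟩
  let p : ((Q.Gen ⊕ Q.Gen) →₀ A) →ₗ[A] Q := toLin Q.coverMap ∘ₗ b.repr.symm.toLinearMap
  let t : Q →ₗ[A] ((Q.Gen ⊕ Q.Gen) →₀ A) := b.repr.toLinearMap ∘ₗ sA
  have hpt : ∀ x, p (t x) = x := fun x => by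
    change toLin Q.coverMap (b.repr.symm (b.repr (s x))) = x
    rw [LinearEquiv.symm_apply_apply]
    exact LinearMap.congr_fun hps x
  let δ : ℕ × (Q.Gen ⊕ Q.Gen) → ℤ := fun j => δ₀ j.2
  let cur := Finsupp.curryLinearEquiv (α := ℕ) (β := Q.Gen ⊕ Q.Gen) A (M := A)
  -- The swindle absorbs `Q` into the first component of the disk, with `ℕ × (Q.Gen ⊕ Q.Gen)`
  -- indexing countably many copies of the basis of the cover. The second component is left alone.
  let Φ : (Q × (free A δ)) ≃ₗ[A] (free A δ) :=
    ((LinearEquiv.refl A Q).prodCongr cur).trans ((swindle p t hpt).trans cur.symm)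
  have ht : ∀ {i : ℤ} {x : Q}, x ∈ Q.deg i → t x ∈ (free A δ₀).deg i := fun {i x} hx j =>
    repr_mem b hbδ (by have := hs.1 i x hx; rwa [add_zero] at this) j
  have hp : ∀ j, p (Finsupp.single j 1) ∈ Q.deg (δ₀ j) := fun j => by
    change toLin Q.coverMap (b.repr.symm (Finsupp.single j 1)) ∈ _
    rw [Module.Basis.repr_symm_single_one]
    exact toLin_mem _ (hbδ j)
  have hΦ : ∀ j, (Φ.symm (Finsupp.single j 1)).1 ∈ Q.deg (δ j) ∧
      (Φ.symm (Finsupp.single j 1)).2 ∈ (free A δ).deg (δ j) := by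
    rintro ⟨k, j⟩
    have hc : ∀ l, cur (Finsupp.single (k, j) 1) l = 0 ∨
        cur (Finsupp.single (k, j) 1) l = Finsupp.single j 1 := fun l => by
      change Finsupp.curry (Finsupp.single (k, j) 1) l = 0 ∨ Finsupp.curry _ l = _
      rw [Finsupp.curry_single]
      by_cases h : k = l
      · subst h
        exact Or.inr Finsupp.single_eq_same
      · exact Or.inl (Finsupp.single_eq_of_ne' h)
    have hc₁ : ∀ l, cur (Finsupp.single (k, j) 1) l ∈ (free A δ₀).deg (δ₀ j) := fun l => by
      rcases hc l with h | h <;> rw [h]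
      · exact zero_mem _
      · exact freeBasis_mem δ₀ j
    have hc₂ : ∀ l, p (cur (Finsupp.single (k, j) 1) l) ∈ Q.deg (δ₀ j) := fun l => by
      rcases hc l with h | h <;> rw [h]
      · rw [map_zero]
        exact zero_mem _
      · exact hp j
    refine ⟨hc₂ 0, fun ⟨l, i⟩ => ?_⟩
    change (swindleInv p t (cur (Finsupp.single (k, j) 1))).2 l i ∈ _
    rw [swindleInv_snd]
    exact add_mem (sub_mem (hc₁ l i) (ht (hc₂ l) i)) (ht (hc₂ (l + 1)) i)
  -- Basis elements of the cover have degree at least `n₀ - 1`; the second component of the new disk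
  -- lowers the bound once more.
  refine ⟨_, δ, ⟨n₀ - 2, fun n hn => ?_⟩, _,
    ((freeBasis A δ).prod (freeBasis A δ)).map
      ((Φ.symm.prodCongr (LinearEquiv.refl A (free A δ))).trans
        (LinearEquiv.prodAssoc A Q (free A δ) (free A δ))), ?_⟩
  · have hf : ∀ n < n₀ - 1, (free A δ).deg n = ⊥ := fun n =>
      isBoundedBelow_free fun j => hδ₀ (Prod.snd j)
    rw [eq_bot_iff]
    rintro ⟨x, y, z⟩ ⟨hx, hy, hz⟩
    exact (Submodule.mem_bot R).2 (Prod.ext ((hn₀ n (by omega)).le hx)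
      (Prod.ext ((hf n (by omega)).le hy) ((hf (n + 1) (by omega)).le hz)))
  · rintro (j | j)
    · refine ⟨δ j, ?_⟩
      have h : (freeBasis A δ).prod (freeBasis A δ) (Sum.inl j) = (freeBasis A δ j, 0) :=
        Prod.ext (Module.Basis.prod_apply_inl_fst _ _ _) (Module.Basis.prod_apply_inl_snd _ _ _)
      rw [Module.Basis.map_apply, h]
      exact ⟨(hΦ j).1, (hΦ j).2, zero_mem _⟩
    · refine ⟨δ j - 1, ?_⟩
      have h : (freeBasis A δ).prod (freeBasis A δ) (Sum.inr j) = (0, freeBasis A δ j) :=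
        Prod.ext (Module.Basis.prod_apply_inr_fst _ _ _) (Module.Basis.prod_apply_inr_snd _ _ _)
      rw [Module.Basis.map_apply, h]
      refine ⟨?_, ?_, ?_⟩
      · change (Φ.symm 0).1 ∈ _
        rw [map_zero]
        exact zero_mem _
      · change (Φ.symm 0).2 ∈ _
        rw [map_zero]
        exact zero_mem _
      · change freeBasis A δ j ∈ (free A δ).deg (δ j - 1 + 1)
        rw [sub_add_cancel]
        exact freeBasis_mem δ j

/-! ### Semi-free modules and quasi-isomorphisms -/

/-- A DG module all of whose homology vanishes. -/
def IsAcyclic (X : DGModule A) : Prop :=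
  ∀ n, ∀ x ∈ X.deg n, X.d x = 0 → ∃ y ∈ X.deg (n + 1), X.d y = x

/-- `Hom_A(M, -)` preserves acyclicity. -/
def HomAcyclic (M : DGModule A) : Prop :=
  ∀ X : DGModule A, X.IsAcyclic → ∀ n, ∀ f ∈ homDeg M X n, homD M X n f = 0 →
    ∃ h ∈ homDeg M X (n + 1), homD M X (n + 1) h = f

/-- Extending a partial null-homotopy from the basis elements of degree less than `k` to
those of degree `k`. -/
lemma exists_extend_nullHomotopy {M X : DGModule A} {ι : Type w} (e : Module.Basis ι A M)
    {δ : ι → ℤ} (he : ∀ j, e j ∈ M.deg (δ j)) (hX : X.IsAcyclic) {n : ℤ} {f : M →ₗ[R] X}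
    (hf : f ∈ homDeg M X n) (df : homD M X n f = 0) (k : ℤ) {h : M →ₗ[R] X}
    (hh : h ∈ homDeg M X (n + 1)) (dh : ∀ j, δ j < k → homD M X (n + 1) h (e j) = f (e j)) :
    ∃ h' ∈ homDeg M X (n + 1), (∀ j, δ j < k + 1 → homD M X (n + 1) h' (e j) = f (e j)) ∧
      ∀ j, δ j < k → h' (e j) = h (e j) := by
  have hDh := homD_mem hh (k := n) (by ring)
  have key : ∀ j, ∃ y ∈ X.deg (δ j + (n + 1)), (δ j < k → y = h (e j)) ∧
      (δ j = k → X.d y - (n + 1).negOnePow • h (M.d (e j)) = f (e j)) := by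
    intro j
    by_cases hj : δ j = k
    · have hde := M.d_mem _ _ (he j)
      -- Since `A` has no negative degrees, `d (e j)` involves only basis elements of degree below
      -- `k`, where `h` is already a null-homotopy. This makes the element bounded below by `y` a
      -- cycle.
      have h₁ : homD M X (n + 1) h (M.d (e j)) = f (M.d (e j)) :=
        eq_of_eq_on_basis e hDh hf (fun l hl => dh l (by omega)) hde he
      have h₂ := LinearMap.congr_fun df (e j)
      rw [homD_apply, M.d_d, map_zero, smul_zero, sub_zero] at h₁
      rw [homD_apply, LinearMap.zero_apply] at h₂
      obtain ⟨y, hy, dy⟩ := hX (δ j + n) (f (e j) + (n + 1).negOnePow • h (M.d (e j)))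
        (add_mem (hf.1 _ _ (he j)) (by
          rw [Units.smul_def]
          refine Submodule.smul_of_tower_mem _ _ ?_
          have := hh.1 _ _ hde
          rwa [show δ j - 1 + (n + 1) = δ j + n by ring] at this))
        (by
          rw [map_add, map_unit_zsmul, h₁, ← h₂, Int.negOnePow_succ]
          simp [Units.smul_def, sub_eq_add_neg])
      refine ⟨y, by rwa [← add_assoc], fun h => absurd h (by omega), fun _ => ?_⟩
      rw [dy, add_sub_cancel_right]
    · exact ⟨h (e j), hh.1 _ _ (he j), fun _ => rfl, fun h => absurd h hj⟩
  choose y hy hy₁ hy₂ using key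
  have hm := homOfBasis_mem e he hy
  have hag : ∀ j, δ j < k → homOfBasis e X (n + 1) y (e j) = h (e j) := fun j hj => by
    rw [homOfBasis_basis, hy₁ j hj]
  refine ⟨_, hm, fun j hj => ?_, hag⟩
  have h₁ : homOfBasis e X (n + 1) y (M.d (e j)) = h (M.d (e j)) :=
    eq_of_eq_on_basis e hm hh (fun l hl => hag l (by omega)) (M.d_mem _ _ (he j)) he
  rw [homD_apply, homOfBasis_basis, h₁]
  by_cases hjk : δ j = k
  · exact hy₂ j hjk
  · have hlt : δ j < k := by omega
    rw [hy₁ j hlt, ← dh j hlt, homD_apply]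

/-- Semi-free DG modules are semi-projective. -/
theorem IsSemiFree.homAcyclic {M : DGModule A} (hM : M.IsSemiFree) : M.HomAcyclic := by
  obtain ⟨⟨n₀, hn₀⟩, ι, e, he⟩ := hM
  choose δ he using he
  intro X hX n f hf df
  let S (k : ℕ) : Type v := {h : M →ₗ[R] X // h ∈ homDeg M X (n + 1) ∧
    ∀ j, δ j < n₀ + k → homD M X (n + 1) h (e j) = f (e j)}
  have step : ∀ (k : ℕ) (h : S k), ∃ h' : S (k + 1), ∀ j, δ j < n₀ + k → h'.1 (e j) = h.1 (e j) := by
    rintro k ⟨h, hh, dh⟩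
    obtain ⟨h', hh', dh', hag⟩ := exists_extend_nullHomotopy e he hX hf df (n₀ + k) hh dh
    exact ⟨⟨h', hh', fun j hj => dh' j (by push_cast at hj; omega)⟩, hag⟩
  choose next hnext using step
  -- The zero map starts the induction, as basis elements of degree below `n₀` vanish.
  let s : ∀ k, S k := fun k => Nat.rec (motive := S) ⟨0, zero_mem _, fun j hj => by
    have : e j = 0 := (hn₀ _ (by simpa using hj)).le (he j)
    rw [this, map_zero, map_zero]⟩ next k
  have hs : ∀ k l : ℕ, k ≤ l → ∀ j, δ j < n₀ + k → (s l).1 (e j) = (s k).1 (e j) := by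
    intro k l hkl
    induction l, hkl using Nat.le_induction with
    | base => exact fun _ _ => rfl
    | succ l hkl ih => exact fun j hj => (hnext l (s l) j (by omega)).trans (ih j hj)
  -- The value on `e j` no longer changes from stage `lev j` on, so the stages glue to one
  -- homomorphism.
  let lev (j : ι) : ℕ := (δ j - n₀ + 1).toNat
  have hlev : ∀ j, δ j < n₀ + lev j := fun j => by
    have := Int.self_le_toNat (δ j - n₀ + 1)
    change δ j < n₀ + ((δ j - n₀ + 1).toNat : ℤ)
    omega
  have hm := homOfBasis_mem e he (N := X) (n := n + 1) (y := fun j => (s (lev j)).1 (e j))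
    (fun j => (s (lev j)).2.1.1 _ _ (he j))
  refine ⟨_, hm, Graded.hom_ext (G := M.deg) fun i x hx =>
    eq_of_eq_on_basis e (homD_mem hm (by ring)) hf (fun j _ => ?_) hx he⟩
  have hag : ∀ l, δ l ≤ δ j →
      homOfBasis e X (n + 1) (fun j => (s (lev j)).1 (e j)) (e l) = (s (lev j)).1 (e l) := by
    intro l hl
    rw [homOfBasis_basis]
    refine (hs (lev l) (lev j) ?_ l (hlev l)).symm
    exact Int.toNat_le_toNat (by omega)
  have hd := eq_of_eq_on_basis e hm (s (lev j)).2.1 (i := δ j - 1) (fun l hl => hag l (by omega))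
    (M.d_mem _ _ (he j)) he
  rw [homD_apply, hag j le_rfl, hd, ← homD_apply]
  exact (s (lev j)).2.2 j (hlev j)

/-- Retracts inherit semi-projectivity. -/
lemma HomAcyclic.of_retract {M N : DGModule A} (hN : N.HomAcyclic) {i : M ⟶ N} {r : N ⟶ M}
    (h : i ≫ r = 𝟙 M) : M.HomAcyclic := by
  intro X hX n f hf df
  obtain ⟨k, hk, dk⟩ := hN X hX n (f ∘ₗ lin r) (comp_lin_mem hf r) (by
    rw [homD_comp_lin, df, LinearMap.zero_comp])
  refine ⟨k ∘ₗ lin i, comp_lin_mem hk i, ?_⟩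
  rw [homD_comp_lin, dk, LinearMap.comp_assoc, lin_comp_lin_eq_id h, LinearMap.comp_id]

section Prod

variable (M N : DGModule A)

/-- The first projection. -/
def prodFst : M.prod N ⟶ M := ⟨LinearMap.fst A M N, fun _ _ hx => hx.1, fun _ => rfl⟩

/-- The second projection. -/
def prodSnd : M.prod N ⟶ N := ⟨LinearMap.snd A M N, fun _ _ hx => hx.2, fun _ => rfl⟩

/-- The first inclusion. -/
def prodInl : M ⟶ M.prod N :=
  ⟨LinearMap.inl A M N, fun _ _ hx => ⟨hx, zero_mem _⟩, fun _ => Prod.ext rfl (map_zero N.d).symm⟩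

lemma prodInl_fst : prodInl M N ≫ prodFst M N = 𝟙 M := rfl

variable {M N}

/-- The morphism from a direct sum with given components. -/
def prodDesc {K : DGModule A} (f : M ⟶ K) (g : N ⟶ K) : M.prod N ⟶ K :=
  prodFst M N ≫ f + prodSnd M N ≫ g

end Prod

/-- By the swindle, `Q` is a direct summand, as a DG module, of a semi-free one. -/
theorem homAcyclic_of_isGradedProjective {Q : DGModule A} (hQ : Q.IsGradedProjective)
    (hb : Q.IsBoundedBelow) : Q.HomAcyclic := by
  obtain ⟨κ, δ, h⟩ := Q.exists_isSemiFree_prod hQ hb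
  exact h.homAcyclic.of_retract (prodInl_fst _ _)

/-! ### Quasiisomorphisms in terms of elements. -/

section QuasiIso

variable {M N : DGModule A} {f : M ⟶ N}

lemma IsQuasiIso.exists_of_boundary (hf : IsQuasiIso f) {n : ℤ} {x : M} (hx : x ∈ M.deg n)
    (dx : M.d x = 0) {y : N} (hy : y ∈ N.deg (n + 1)) (dy : N.d y = toLin f x) :
    ∃ x' ∈ M.deg (n + 1), M.d x' = x := by
  have h : homologyMap f n (Submodule.Quotient.mk ⟨x, hx, dx⟩) = 0 :=
    (Submodule.Quotient.mk_eq_zero _).2 ⟨y, hy, dy⟩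
  rw [map_eq_zero_iff _ (hf n).1] at h
  exact (Submodule.Quotient.mk_eq_zero _).1 h

lemma IsQuasiIso.exists_of_cycle (hf : IsQuasiIso f) {n : ℤ} {y : N} (hy : y ∈ N.deg n)
    (dy : N.d y = 0) : ∃ x ∈ M.deg n, M.d x = 0 ∧ ∃ z ∈ N.deg (n + 1), N.d z = toLin f x - y := by
  obtain ⟨x, hx⟩ := (hf n).2 (Submodule.Quotient.mk ⟨y, hy, dy⟩)
  obtain ⟨⟨x, hx', dx⟩, rfl⟩ := Submodule.mkQ_surjective _ x
  obtain ⟨z, hz, dz⟩ := (Submodule.Quotient.eq _).1 hx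
  exact ⟨x, hx', dx, z, hz, dz⟩

lemma isQuasiIso_of_exists
    (h₁ : ∀ n, ∀ x ∈ M.deg n, M.d x = 0 → ∀ y ∈ N.deg (n + 1), N.d y = toLin f x →
      ∃ x' ∈ M.deg (n + 1), M.d x' = x)
    (h₂ : ∀ n, ∀ y ∈ N.deg n, N.d y = 0 → ∃ x ∈ M.deg n, M.d x = 0 ∧ toLin f x = y) :
    IsQuasiIso f := by
  intro n
  refine ⟨(injective_iff_map_eq_zero _).2 fun x hx => ?_, fun y => ?_⟩
  · obtain ⟨⟨x, hx', dx⟩, rfl⟩ := Submodule.mkQ_surjective _ x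
    obtain ⟨y, hy, dy⟩ := (Submodule.Quotient.mk_eq_zero _).1 hx
    exact (Submodule.Quotient.mk_eq_zero _).2 (h₁ n x hx' dx y hy dy)
  · obtain ⟨⟨y, hy, dy⟩, rfl⟩ := Submodule.mkQ_surjective _ y
    obtain ⟨x, hx, dx, rfl⟩ := h₂ n y hy dy
    exact ⟨Submodule.Quotient.mk ⟨x, hx, dx⟩, rfl⟩

end QuasiIso

lemma IsContraction.d_apply {L : DGModule A} {c : L →ₗ[R] L} (hc : L.IsContraction c) {x : L}
    (dx : L.d x = 0) : L.d (c x) = x := by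
  have := LinearMap.congr_fun hc.2 x
  rwa [homD_apply, dx, map_zero, smul_zero, sub_zero] at this

lemma isContraction_disk (X : DGModule A) : X.disk.IsContraction (diskContraction X) :=
  ⟨diskContraction_mem X, homD_diskContraction X⟩

lemma isQuasiIso_prodFst (M : DGModule A) {L : DGModule A} {c : L →ₗ[R] L}
    (hc : L.IsContraction c) : IsQuasiIso (prodFst M L) := by
  refine isQuasiIso_of_exists (fun n x hx dx y hy dy => ?_) (fun n y hy dy => ?_)
  · exact ⟨(y, c x.2), ⟨hy, hc.1.1 _ _ hx.2⟩, Prod.ext dy (hc.d_apply (congrArg Prod.snd dx))⟩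
  · exact ⟨(y, 0), ⟨hy, zero_mem _⟩, Prod.ext dy (map_zero L.d), rfl⟩

/-- Bounded below graded-projective DG modules have semi-free resolutions. -/
theorem nonempty_semiFreeResolution {Q : DGModule A} (hQ : Q.IsGradedProjective)
    (hb : Q.IsBoundedBelow) : Nonempty (SemiFreeResolution Q) := by
  obtain ⟨κ, δ, h⟩ := Q.exists_isSemiFree_prod hQ hb
  exact ⟨⟨_, h, prodFst _ _, isQuasiIso_prodFst Q (isContraction_disk _)⟩⟩

/-! ### Quasiisomorphisms that are homotopy equivalences. -/

section Comparison

variable {F Q : DGModule A} (π : F ⟶ Q)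

/-- The surjection that replaces a morphism up to homotopy. -/
abbrev replace : F.prod Q.cover ⟶ Q := prodDesc π Q.coverMap

lemma replace_surjective : Function.Surjective (toLin (replace π)) := fun y => by
  obtain ⟨x, rfl⟩ := Q.coverMap_surjective y
  exact ⟨(0, x), by
    change toLin π 0 + toLin Q.coverMap x = _
    rw [map_zero, zero_add]⟩

/-- The long exact sequence argument, done by elements: the contractible summand makes the map
surjective without affecting homology. -/
lemma isAcyclic_ker_replace (hπ : IsQuasiIso π) : (ker (replace π)).IsAcyclic := by
  rintro n ⟨⟨f, e⟩, hfe⟩ ⟨hf, he⟩ hd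
  replace hf : f ∈ F.deg n := hf
  replace he : e ∈ Q.cover.deg n := he
  have hd' := congrArg Subtype.val hd
  have df : F.d f = 0 := congrArg Prod.fst hd'
  have de : Q.cover.d e = 0 := congrArg Prod.snd hd'
  have hp : toLin π f + toLin Q.coverMap e = 0 := hfe
  have hc := isContraction_disk (free A Q.genDeg)
  set c := diskContraction (free A Q.genDeg)
  have hce : c e ∈ Q.cover.deg (n + 1) := hc.1.1 _ _ he
  have dce : Q.cover.d (c e) = e := hc.d_apply de
  obtain ⟨f', hf', df'⟩ := hπ.exists_of_boundary hf df (y := -toLin Q.coverMap (c e))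
    (neg_mem (toLin_mem _ hce)) (by
      rw [map_neg, ← toLin_d, dce, eq_comm, eq_neg_iff_add_eq_zero, hp])
  obtain ⟨w, hw, dw, q, hq, dq⟩ := hπ.exists_of_cycle
    (y := toLin π f' + toLin Q.coverMap (c e))
    (add_mem (toLin_mem _ hf') (toLin_mem _ hce)) (by
      rw [map_add, ← toLin_d, ← toLin_d, df', dce, hp])
  obtain ⟨e', he', rfl⟩ := exists_preimage (f := lin Q.coverMap) (k := 0) (n := n + 1 + 1)
    (fun i x hx => by simpa using toLin_mem Q.coverMap hx) Q.coverMap_surjective hq (by simp)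
  have dq' : toLin Q.coverMap (Q.cover.d e') =
      toLin π w - (toLin π f' + toLin Q.coverMap (c e)) := by
    rw [toLin_d]; exact dq
  -- The pair `(f', c e)` has the right differential but may leave the kernel. The error is a cycle
  -- of `Q`, hence `π w` minus a boundary; subtracting `w` and adding `d e'` cancels it without
  -- changing the differential.
  refine ⟨⟨(f' - w, c e + Q.cover.d e'), ?_⟩, ⟨sub_mem hf' hw, add_mem hce ?_⟩,
    Subtype.ext (Prod.ext ?_ ?_)⟩
  · change toLin π (f' - w) + toLin Q.coverMap (c e + Q.cover.d e') = 0
    rw [map_sub, map_add, dq']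
    abel
  · exact Q.cover.d_mem' he' (by ring)
  · change F.d (f' - w) = f
    rw [map_sub, df', dw, sub_zero]
  · change Q.cover.d (c e + Q.cover.d e') = e
    rw [map_add, dce, Q.cover.d_d, add_zero]

/-- A semi-free resolution of a bounded below graded-projective DG module computes the homology
of the complex of homomorphisms. -/
theorem homHomology_equiv_of_quasiIso (hF : F.HomAcyclic) (hQ : Q.HomAcyclic)
    (hQ' : Q.IsGradedProjective) (hπ : IsQuasiIso π) (P : DGModule A) (n : ℤ) :
    Nonempty (homHomology Q P n ≃+ homHomology F P n) := by
  have hK := isAcyclic_ker_replace π hπ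
  have hc := isContraction_disk (free A Q.genDeg)
  set c := diskContraction (free A Q.genDeg)
  have hι := kerι_injective (replace π)
  obtain ⟨s, hs, hps⟩ := hQ' _ _ (replace π) (replace_surjective π) 0 LinearMap.id id_mem_homDeg
  have hpds : lin (replace π) ∘ₗ homD _ _ 0 s = 0 := by
    rw [← homD_lin_comp, hps, homD_id]
  obtain ⟨τ, hτ, hιτ⟩ := exists_lift_kernel hι (exact_kerι (replace π))
    (homD_mem hs (k := -1) (by norm_num)) (LinearMap.congr_fun hpds)
  -- The differential of the graded section `s` is a cycle with values in the acyclic kernel, hence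
  -- bounds some `t`; subtracting `t` turns `s` into a section `σ` that is a morphism.
  obtain ⟨t, ht, dt⟩ := hQ _ hK (-1) τ hτ (lin_comp_cancel hι (by
    rw [← homD_lin_comp, hιτ, homD_homD _ (by norm_num), LinearMap.comp_zero]))
  rw [show (-1 : ℤ) + 1 = 0 by norm_num] at ht dt
  let σ := s - lin (kerι (replace π)) ∘ₗ t
  have hσ : σ ∈ homDeg Q _ 0 := sub_mem hs (lin_comp_mem _ ht)
  have dσ : homD Q _ 0 σ = 0 := by
    rw [map_sub, homD_lin_comp, dt, hιτ, sub_self]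
  have hpι : lin (replace π) ∘ₗ lin (kerι (replace π)) = 0 :=
    LinearMap.ext (exact_kerι (replace π)).apply_apply_eq_zero
  have hpσ : lin (replace π) ∘ₗ σ = LinearMap.id := by
    rw [LinearMap.comp_sub, hps, ← LinearMap.comp_assoc, hpι, LinearMap.zero_comp, sub_zero]
  have hψ₀ : lin (prodInl F Q.cover) - σ ∘ₗ lin π ∈ homDeg F _ 0 :=
    sub_mem (lin_mem _) (comp_lin_mem hσ π)
  have hpψ : lin (replace π) ∘ₗ (lin (prodInl F Q.cover) - σ ∘ₗ lin π) = 0 := by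
    rw [LinearMap.comp_sub, ← LinearMap.comp_assoc, hpσ]
    ext x
    change toLin π x + toLin Q.coverMap 0 - toLin π x = 0
    simp
  obtain ⟨ψ, hψ, hιψ⟩ := exists_lift_kernel hι (exact_kerι (replace π)) hψ₀
    (LinearMap.congr_fun hpψ)
  -- The inclusion of `F` and `σ ∘ π` agree after projection to `Q`, so their difference lands in
  -- the acyclic kernel and is null-homotopic.
  obtain ⟨k, hk, dk⟩ := hF _ hK 0 ψ hψ (lin_comp_cancel hι (by
    rw [← homD_lin_comp, hιψ, map_sub, homD_lin, homD_comp_lin, dσ]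
    simp))
  rw [zero_add] at hk dk
  -- The homotopy inverse of `π` is the `F`-component of `σ`. One composite differs from the
  -- identity by a map through the contractible cover, the other by the null-homotopic map just
  -- found.
  refine homHomology_equiv (m := 0) (θ := lin π) (δ := lin (prodFst F Q.cover) ∘ₗ σ)
    (h := -(lin Q.coverMap ∘ₗ c ∘ₗ lin (prodSnd F Q.cover) ∘ₗ σ))
    (h' := -(lin (prodFst F Q.cover) ∘ₗ lin (kerι (replace π)) ∘ₗ k))
    (lin_mem π) (homD_lin π) (lin_comp_mem _ hσ) ?_
    (neg_mem (lin_comp_mem _ (comp_mem_homDeg hc.1 (lin_comp_mem _ hσ) (by norm_num)))) ?_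
    (neg_mem (lin_comp_mem _ (lin_comp_mem _ hk))) ?_ P (by ring)
  · change homD Q F 0 _ = 0
    rw [homD_lin_comp, dσ, LinearMap.comp_zero]
  · rw [map_neg, homD_lin_comp, homD_comp (m := 0) (n := 1) _ _ (by norm_num), hc.2,
      homD_lin_comp, dσ, ← hpσ]
    ext x
    change toLin π (σ x).1 = toLin π (σ x).1 + toLin Q.coverMap (σ x).2 +
      -toLin Q.coverMap ((σ x).2 + (1 : ℤ).negOnePow • c 0)
    simp
  · rw [map_neg, homD_lin_comp, homD_lin_comp, dk, hιψ]
    ext x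
    change (σ (toLin π x)).1 = x + -(x - (σ (toLin π x)).1)
    abel

end Comparison

end DGModule

end

theorem mainTheorem7 {R : Type u} [CommRing R] (A : DGAlgebra.{u, v} R) (P Q : DGModule A)
    (hQ : Q.IsGradedProjective) (hb : Q.IsBoundedBelow) :
    Nonempty (DGModule.CatProjectiveResolution Q) ∧
    Nonempty (DGModule.SemiFreeResolution Q) ∧
    ∀ (L : DGModule.CatProjectiveResolution Q) (F : DGModule.SemiFreeResolution Q) (i : ℕ),
      1 ≤ i → Nonempty (L.YExt P i ≃+ F.Ext P (i : ℤ)) := by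
  refine ⟨⟨Q.catProjectiveResolution⟩, DGModule.nonempty_semiFreeResolution hQ hb, ?_⟩
  intro L F i hi
  obtain ⟨i, rfl⟩ := Nat.exists_eq_add_of_le' hi
  obtain ⟨e₁⟩ := DGModule.CatProjectiveResolution.yExt_equiv P i L hQ
  obtain ⟨e₂⟩ := DGModule.homHomology_equiv_of_quasiIso F.π F.semiFree.homAcyclic
    (DGModule.homAcyclic_of_isGradedProjective hQ hb) hQ F.quasiIso P (-((i + 1 : ℕ) : ℤ))
  exact ⟨e₁.symm.trans e₂⟩
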